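/- Let $n\ge 2$ and $s\ge 1$ be integers and let $M$ be a nonempty smooth manifold of dimension $2n+s$ with an $S$-structure $(f,\xi_1,\dots,\xi_s,\eta^1,\dots,\eta^s,g)$. This means that $f$ is a smooth tensor field of type $(1,1)$, $\xi_1,\dots,\xi_s$ are smooth vector fields, $\eta^1,\dots,\eta^s$ are smooth $1$-forms and $g$ is a smooth Riemannian metric on $M$ such that, for all vector fields $X,Y$ and all $\alpha,\beta\in\{1,\dots,s\}$, $$f^2=-I+\sum_{\alpha=1}^s\eta^\alpha\otimes\xi_\alpha,\quad \eta^\alpha(\xi_\beta)=\delta_{\alpha\beta},\quad f\xi_\alpha=0,\quad \eta^\alpha\circ f=0,$$ $$g(fX,fY)=g(X,Y)-\sum_{\alpha=1}^s\eta^\alpha(X)\eta^\alpha(Y),$$ $$[f,f]+2\sum_{\alpha=1}^s d\eta^\alpha\otimes\xi_\alpha=0,\qquad d\eta^\alpha=\Phi \quad (1\le\alpha\le s),$$ where $\Phi(X,Y)=g(X,fY)$, $[f,f](X,Y)=f^2[X,Y]+[fX,fY]-f[fX,Y]-f[X,fY]$ is the Nijenhuis torsion of $f$, and $2\,d\eta(X,Y)=X(\eta(Y))-Y(\eta(X))-\eta([X,Y])$.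 Let $\nabla$ be the Levi-Civita connection of $g$, let $R(X,Y)Z=\nabla_X\nabla_YZ-\nabla_Y\nabla_XZ-\nabla_{[X,Y]}Z$ be its curvature tensor, and let $$K(X,Y)=\frac{g(R(X,Y)Y,X)}{g(X,X)g(Y,Y)-g(X,Y)^2}$$ be its sectional curvature, with $K(X,Y)=0$ if $X,Y$ are linearly dependent. Let $\mathcal L$ be the distribution orthogonal to $\xi_1,\dots,\xi_s$. If the $\mathcal L$-sectional curvature of $\nabla$ is constant, equal to $c\in\mathbb R$, that is, if $K(X,Y)=c$ for every point $p\in M$ and all linearly independent $X,Y\in\mathcal L_p$, then $c=s$. In this case the scalar curvature of $M$ is $$\tau=\frac12\sum_{i,j=1}^{2n+s}K(e_i,e_j)=ns(2n+1)$$ at every point $p$ of $M$ and for every orthonormal basis $e_1,\dots,e_{2n+s}$ of $T_pM$. -/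

import Mathlib

open Bundle VectorField
open scoped Manifold ContDiff

set_option linter.unusedSectionVars false

namespace SManifold

noncomputable section

/- Throughout, `M` is a smooth manifold without boundary modelled on the finite-dimensional real
vector space `E`, and `g` is a smooth Riemannian metric on `M`.
A vector field on `M` is a section `X : Π x : M, TangentSpace 𝓘(ℝ, E) x`; its differentiability
at a point is `MDiffAt (T% X) x`, its smoothness is `CMDiff ∞ (T% X)`. -/
variable {E : Type*} [NormedAddCommGroup E] [NormedSpace ℝ E] [FiniteDimensional ℝ E]
  {M : Type*} [TopologicalSpace M] [ChartedSpace E M] [IsManifold 𝓘(ℝ, E) ∞ M]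
  (g : ContMDiffRiemannianMetric 𝓘(ℝ, E) ∞ E (fun x : M ↦ TangentSpace 𝓘(ℝ, E) x))

/-! ### The Levi-Civita (Riemannian) connection -/

/-- The function `g (X, Y)` on `M`. -/
def metricFun (X Y : Π x : M, TangentSpace 𝓘(ℝ, E) x) (x : M) : ℝ := g.inner x (X x) (Y x)

/-- The Koszul expression, that is, `g (∇_X Y, Z)` for the Levi-Civita connection `∇`. -/
def koszul (Y X Z : Π x : M, TangentSpace 𝓘(ℝ, E) x) (x : M) : ℝ :=
  (1 / 2 : ℝ) *
    (mvfderiv 𝓘(ℝ, E) (metricFun g Y Z) x (X x)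
      + mvfderiv 𝓘(ℝ, E) (metricFun g X Z) x (Y x)
      - mvfderiv 𝓘(ℝ, E) (metricFun g X Y) x (Z x)
      + g.inner x (mlieBracket 𝓘(ℝ, E) X Y x) (Z x)
      - g.inner x (mlieBracket 𝓘(ℝ, E) X Z x) (Y x)
      - g.inner x (mlieBracket 𝓘(ℝ, E) Y Z x) (X x))

section Koszul

variable {x : M} {X X' Y Y' Z Z' : Π x : M, TangentSpace 𝓘(ℝ, E) x} {φ : M → ℝ}

theorem metricFun_comm : metricFun g X Y = metricFun g Y X :=
  funext fun x ↦ g.symm x (X x) (Y x)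

theorem metricFun_add : metricFun g (X + X') Y = metricFun g X Y + metricFun g X' Y := by
  ext x; simp [metricFun]

theorem metricFun_smul : metricFun g (φ • X) Y = φ * metricFun g X Y := by
  ext x; simp [metricFun]

theorem metricFun_mdiff (hX : MDiffAt (T% X) x) (hY : MDiffAt (T% Y) x) :
    MDiffAt (metricFun g X Y) x := by
  have : MDifferentiableAt 𝓘(ℝ, E) (𝓘(ℝ, E).prod 𝓘(ℝ))
      (fun m ↦ TotalSpace.mk' ℝ (E := Bundle.Trivial M ℝ) m (g.inner m (X m) (Y m))) x := by
    apply MDifferentiableAt.clm_bundle_apply₂ (F₁ := E) (F₂ := E)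
    · exact g.contMDiff.mdifferentiableAt (by simp)
    · exact hX
    · exact hY
  simp only [mdifferentiableAt_totalSpace] at this
  exact this.2

theorem koszul_add_left (hX : MDiffAt (T% X) x) (hX' : MDiffAt (T% X') x)
    (hY : MDiffAt (T% Y) x) (hZ : MDiffAt (T% Z) x) :
    koszul g Y (X + X') Z x = koszul g Y X Z x + koszul g Y X' Z x := by
  have h1 := mvfderiv_add (metricFun_mdiff g hX hZ) (metricFun_mdiff g hX' hZ)
  have h2 := mvfderiv_add (metricFun_mdiff g hX hY) (metricFun_mdiff g hX' hY)
  simp only [koszul, metricFun_add, h1, h2, mlieBracket_add_left hX hX', Pi.add_apply, map_add,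
    add_apply]
  ring

theorem koszul_smul_left (hφ : MDiffAt φ x) (hX : MDiffAt (T% X) x)
    (hY : MDiffAt (T% Y) x) (hZ : MDiffAt (T% Z) x) :
    koszul g Y (φ • X) Z x = φ x * koszul g Y X Z x := by
  have h1 := mvfderiv_mul hφ (metricFun_mdiff g hX hZ)
  have h2 := mvfderiv_mul hφ (metricFun_mdiff g hX hY)
  simp only [koszul, metricFun_smul, h1, h2, mlieBracket_smul_left hφ hX, Pi.smul_apply', map_add,
    map_smul, map_neg, add_apply, smul_apply,
    neg_apply, smul_eq_mul, neg_smul]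
  simp only [metricFun]
  ring

theorem koszul_add_right (hX : MDiffAt (T% X) x) (hY : MDiffAt (T% Y) x)
    (hZ : MDiffAt (T% Z) x) (hZ' : MDiffAt (T% Z') x) :
    koszul g Y X (Z + Z') x = koszul g Y X Z x + koszul g Y X Z' x := by
  have h1 := mvfderiv_add (metricFun_mdiff g hZ hX) (metricFun_mdiff g hZ' hX)
  have h2 := mvfderiv_add (metricFun_mdiff g hZ hY) (metricFun_mdiff g hZ' hY)
  simp only [koszul, metricFun_comm g (Y := Z + Z'), metricFun_comm g (Y := Z),
    metricFun_comm g (Y := Z'), metricFun_add, h1, h2, mlieBracket_add_right hZ hZ', Pi.add_apply,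
    map_add, add_apply]
  ring

theorem koszul_smul_right (hφ : MDiffAt φ x) (hX : MDiffAt (T% X) x)
    (hY : MDiffAt (T% Y) x) (hZ : MDiffAt (T% Z) x) :
    koszul g Y X (φ • Z) x = φ x * koszul g Y X Z x := by
  have h1 := mvfderiv_mul hφ (metricFun_mdiff g hZ hX)
  have h2 := mvfderiv_mul hφ (metricFun_mdiff g hZ hY)
  simp only [koszul, metricFun_comm g (Y := φ • Z), metricFun_comm g (Y := Z), metricFun_smul,
    h1, h2, mlieBracket_smul_right hφ hZ, Pi.smul_apply', map_add, map_smul, add_apply, smul_apply,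
    smul_eq_mul]
  simp only [metricFun]
  rw [g.symm x (Z x) (Y x), g.symm x (Z x) (X x)]
  ring

theorem koszul_add (hX : MDiffAt (T% X) x) (hY : MDiffAt (T% Y) x)
    (hY' : MDiffAt (T% Y') x) (hZ : MDiffAt (T% Z) x) :
    koszul g (Y + Y') X Z x = koszul g Y X Z x + koszul g Y' X Z x := by
  have h1 := mvfderiv_add (metricFun_mdiff g hY hX) (metricFun_mdiff g hY' hX)
  have h2 := mvfderiv_add (metricFun_mdiff g hY hZ) (metricFun_mdiff g hY' hZ)
  simp only [koszul, metricFun_comm g (X := X) (Y := Y + Y'), metricFun_comm g (X := X) (Y := Y),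
    metricFun_comm g (X := X) (Y := Y'), metricFun_add, h1, h2, mlieBracket_add_right hY hY',
    mlieBracket_add_left hY hY', Pi.add_apply, map_add, add_apply]
  ring

theorem koszul_smul (hφ : MDiffAt φ x) (hX : MDiffAt (T% X) x)
    (hY : MDiffAt (T% Y) x) (hZ : MDiffAt (T% Z) x) :
    koszul g (φ • Y) X Z x = φ x * koszul g Y X Z x
      + mvfderiv 𝓘(ℝ, E) φ x (X x) * g.inner x (Y x) (Z x) := by
  have h1 := mvfderiv_mul hφ (metricFun_mdiff g hY hX)
  have h2 := mvfderiv_mul hφ (metricFun_mdiff g hY hZ)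
  simp only [koszul, metricFun_comm g (X := X) (Y := φ • Y), metricFun_comm g (X := X) (Y := Y),
    metricFun_smul, h1, h2, mlieBracket_smul_right hφ hY, mlieBracket_smul_left hφ hY,
    Pi.smul_apply', map_add, map_smul, map_neg, neg_smul, neg_apply, add_apply, smul_apply,
    smul_eq_mul]
  simp only [metricFun]
  rw [g.symm x (Y x) (X x)]
  ring

theorem koszul_tensorial₁ (hY : MDiffAt (T% Y) x) (hZ : MDiffAt (T% Z) x) :
    TensorialAt 𝓘(ℝ, E) E (fun X ↦ koszul g Y X Z x) x where
  smul hφ hX := koszul_smul_left g hφ hX hY hZ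
  add hX hX' := koszul_add_left g hX hX' hY hZ

theorem koszul_tensorial₂ (hY : MDiffAt (T% Y) x) (hX : MDiffAt (T% X) x) :
    TensorialAt 𝓘(ℝ, E) E (fun Z ↦ koszul g Y X Z x) x where
  smul hφ hZ := koszul_smul_right g hφ hX hY hZ
  add hZ hZ' := koszul_add_right g hX hY hZ hZ'

/-- The Koszul expression as a bilinear form on `T_x M` in the values of `X` and `Z` at `x`. -/
def koszulHom (x : M) (Y : Π x : M, TangentSpace 𝓘(ℝ, E) x) (hY : MDiffAt (T% Y) x) :
    TangentSpace 𝓘(ℝ, E) x →L[ℝ] TangentSpace 𝓘(ℝ, E) x →L[ℝ] ℝ :=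
  TensorialAt.mkHom₂ (fun X Z ↦ koszul g Y X Z x) x
    (fun _ hZ ↦ koszul_tensorial₁ g hY hZ) (fun _ hX ↦ koszul_tensorial₂ g hY hX)

theorem koszulHom_apply (hX : MDiffAt (T% X) x) (hY : MDiffAt (T% Y) x) (hZ : MDiffAt (T% Z) x) :
    koszulHom g x Y hY (X x) (Z x) = koszul g Y X Z x :=
  TensorialAt.mkHom₂_apply _ _ hX hZ

end Koszul

theorem inner_injective (x : M) : Function.Injective (g.inner x) := by
  rw [injective_iff_map_eq_zero]
  intro v hv
  by_contra h
  have := g.pos x v h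
  simp [hv] at this

instance finiteDimensional_tangentSpace (x : M) : FiniteDimensional ℝ (TangentSpace 𝓘(ℝ, E) x) :=
  inferInstanceAs (FiniteDimensional ℝ E)

instance t2Space_tangentSpace (x : M) : T2Space (TangentSpace 𝓘(ℝ, E) x) :=
  inferInstanceAs (T2Space E)

/-- The musical isomorphism `v ↦ g (v, ·)` from `T_x M` to its dual. -/
def flat (x : M) : TangentSpace 𝓘(ℝ, E) x ≃ₗ[ℝ] (TangentSpace 𝓘(ℝ, E) x →L[ℝ] ℝ) :=
  LinearMap.linearEquivOfInjective (g.inner x).toLinearMap (inner_injective g x) (by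
    have e : (TangentSpace 𝓘(ℝ, E) x →ₗ[ℝ] ℝ) ≃ₗ[ℝ] (TangentSpace 𝓘(ℝ, E) x →L[ℝ] ℝ) :=
      LinearMap.toContinuousLinearMap
    exact (Subspace.dual_finrank_eq (K := ℝ) (V := TangentSpace 𝓘(ℝ, E) x)).symm.trans
      e.finrank_eq)

theorem inner_flat_symm (x : M) (l : TangentSpace 𝓘(ℝ, E) x →L[ℝ] ℝ) :
    g.inner x ((flat g x).symm l) = l :=
  (flat g x).apply_symm_apply l

open Classical in
/-- The underlying map of the Levi-Civita connection: `∇_X Y` at `x` is the vector with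
`g (∇_X Y, Z) = koszul g Y X Z x` for all `Z`. Only the values on vector fields `Y` that are
differentiable at `x` are meaningful. -/
def leviCivitaFun (Y : Π x : M, TangentSpace 𝓘(ℝ, E) x) (x : M) :
    TangentSpace 𝓘(ℝ, E) x →L[ℝ] TangentSpace 𝓘(ℝ, E) x :=
  if hY : MDiffAt (T% Y) x then
    LinearMap.toContinuousLinearMap
      ((flat g x).symm.toLinearMap ∘ₗ (koszulHom g x Y hY).toLinearMap)
  else 0

theorem inner_leviCivitaFun {x : M} {X Y Z : Π x : M, TangentSpace 𝓘(ℝ, E) x}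
    (hX : MDiffAt (T% X) x) (hY : MDiffAt (T% Y) x) (hZ : MDiffAt (T% Z) x) :
    g.inner x (leviCivitaFun g Y x (X x)) (Z x) = koszul g Y X Z x := by
  rw [leviCivitaFun, dif_pos hY, ← koszulHom_apply g hX hY hZ]
  exact congrArg (fun l ↦ l (Z x)) (inner_flat_symm g x (koszulHom g x Y hY (X x)))

/-- Vectors in `T_x M` are determined by their inner products with the values at `x` of
differentiable vector fields. -/
theorem clm_ext {x : M} {A B : TangentSpace 𝓘(ℝ, E) x →L[ℝ] TangentSpace 𝓘(ℝ, E) x}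
    (h : ∀ X Z : Π x : M, TangentSpace 𝓘(ℝ, E) x, MDiffAt (T% X) x → MDiffAt (T% Z) x →
      g.inner x (A (X x)) (Z x) = g.inner x (B (X x)) (Z x)) : A = B := by
  ext u
  apply inner_injective g x
  ext w
  simpa using h (FiberBundle.extend E u) (FiberBundle.extend E w)
    (FiberBundle.mdifferentiableAt_extend ..) (FiberBundle.mdifferentiableAt_extend ..)

/-- The Levi-Civita (Riemannian) connection of `g`; `leviCivita g Y x (X x)` is `(∇_X Y) x`. -/
def leviCivita : CovariantDerivative 𝓘(ℝ, E) E (fun x : M ↦ TangentSpace 𝓘(ℝ, E) x) where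
  toFun := leviCivitaFun g
  isCovariantDerivativeOnUniv :=
    { add := by
        intro Y Y' x hY hY' _
        refine clm_ext g fun X Z hX hZ ↦ ?_
        have hs : MDiffAt (T% (Y + Y')) x := mdifferentiableAt_add_section hY hY'
        simp only [add_apply, map_add]
        rw [inner_leviCivitaFun g hX hs hZ, inner_leviCivitaFun g hX hY hZ,
          inner_leviCivitaFun g hX hY' hZ, koszul_add g hX hY hY' hZ]
      leibniz := by
        intro Y φ x hY hφ _
        refine clm_ext g fun X Z hX hZ ↦ ?_
        have hs : MDiffAt (T% (φ • Y)) x := hφ.smul_section hY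
        simp only [add_apply, smul_apply, map_add, map_smul, ContinuousLinearMap.smulRight_apply,
          smul_eq_mul]
        rw [inner_leviCivitaFun g hX hs hZ, inner_leviCivitaFun g hX hY hZ,
          koszul_smul g hφ hX hY hZ] }

theorem inner_leviCivita {x : M} {X Y Z : Π x : M, TangentSpace 𝓘(ℝ, E) x}
    (hX : MDiffAt (T% X) x) (hY : MDiffAt (T% Y) x) (hZ : MDiffAt (T% Z) x) :
    g.inner x (leviCivita g Y x (X x)) (Z x) = koszul g Y X Z x :=
  inner_leviCivitaFun g hX hY hZ

/-- The Levi-Civita connection is symmetric. -/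
theorem leviCivita_torsion : (leviCivita g).torsion = 0 := by
  rw [CovariantDerivative.torsion_eq_zero_iff]
  intro X Y x hX hY
  apply inner_injective g x
  ext w
  have hZ : MDiffAt (T% (FiberBundle.extend E w)) x := FiberBundle.mdifferentiableAt_extend ..
  have h1 := inner_leviCivita g hX hY hZ
  have h2 := inner_leviCivita g hY hX hZ
  simp only [FiberBundle.extend_apply_self] at h1 h2
  rw [map_sub, sub_apply, h1, h2]
  simp only [koszul, metricFun_comm g (X := Y) (Y := X), mlieBracket_swap_apply (V := Y) (W := X),
    map_neg, neg_apply, FiberBundle.extend_apply_self]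
  ring

/-- The Levi-Civita connection is metric:
`X (g (Y, Z)) = g (∇_X Y, Z) + g (Y, ∇_X Z)`. -/
theorem leviCivita_metric {x : M} {X Y Z : Π x : M, TangentSpace 𝓘(ℝ, E) x}
    (hX : MDiffAt (T% X) x) (hY : MDiffAt (T% Y) x) (hZ : MDiffAt (T% Z) x) :
    mvfderiv 𝓘(ℝ, E) (metricFun g Y Z) x (X x)
      = g.inner x (leviCivita g Y x (X x)) (Z x) + g.inner x (Y x) (leviCivita g Z x (X x)) := by
  rw [g.symm x (Y x), inner_leviCivita g hX hY hZ, inner_leviCivita g hX hZ hY]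
  simp only [koszul, metricFun_comm g (X := Z) (Y := Y), mlieBracket_swap_apply (V := Z) (W := Y),
    map_neg, neg_apply]
  ring

/-! ### Curvature -/

/-- The curvature `R(X, Y) Z = ∇_X ∇_Y Z - ∇_Y ∇_X Z - ∇_[X, Y] Z` of the Levi-Civita connection
on vector fields. -/
def curvatureField (X Y Z : Π x : M, TangentSpace 𝓘(ℝ, E) x) (x : M) : TangentSpace 𝓘(ℝ, E) x :=
  leviCivita g (fun y ↦ leviCivita g Z y (Y y)) x (X x)
    - leviCivita g (fun y ↦ leviCivita g Z y (X y)) x (Y x)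
    - leviCivita g Z x (mlieBracket 𝓘(ℝ, E) X Y x)

/-- The curvature `R(u, v) w` on tangent vectors at `x`. As the curvature is a tensor, it is
computed with any extension of `u`, `v`, `w` to vector fields that are smooth near `x`; here
`FiberBundle.extend`, which is one. -/
def curvature (x : M) (u v w : TangentSpace 𝓘(ℝ, E) x) : TangentSpace 𝓘(ℝ, E) x :=
  curvatureField g (FiberBundle.extend E u) (FiberBundle.extend E v) (FiberBundle.extend E w) x

/-- The sectional curvature of the plane spanned by `u` and `v`:
`K(u, v) = g (R(u, v) v, u) / (g (u, u) g (v, v) - g (u, v) ^ 2)`. It is `0` if `u` and `v` are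
linearly dependent. -/
def sectionalCurvature (x : M) (u v : TangentSpace 𝓘(ℝ, E) x) : ℝ :=
  g.inner x (curvature g x u v v) u
    / (g.inner x u u * g.inner x v v - g.inner x u v ^ 2)

/-- The scalar curvature `τ = (1 / 2) ∑ i, j, K(e i, e j)` at `x`, computed in the orthonormal basis
`e` of `T_x M`. -/
def scalarCurvature {ι : Type*} [Fintype ι] (x : M) (e : ι → TangentSpace 𝓘(ℝ, E) x) : ℝ :=
  (1 / 2 : ℝ) * ∑ i, ∑ j, sectionalCurvature g x (e i) (e j)

/-- `e` is a `g`-orthonormal family in `T_x M`. -/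
def IsOrthonormal {ι : Type*} [DecidableEq ι] (x : M) (e : ι → TangentSpace 𝓘(ℝ, E) x) : Prop :=
  ∀ i j, g.inner x (e i) (e j) = if i = j then 1 else 0

/-! ### Metric `f`-structures and `S`-structures -/

/-- A metric `f`-structure on `(M, g)`: a tensor field `f` of type `(1, 1)`, structure vector fields
`ξ 1, …, ξ s` and `1`-forms `η 1, …, η s`, all smooth, with
`f² = - I + ∑ α, η α ⊗ ξ α`, `η α (ξ β) = δ`, `f (ξ α) = 0`, `η α ∘ f = 0` and
`g (f X, f Y) = g (X, Y) - ∑ α, η α (X) η α (Y)`. -/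
structure MetricFStructure (s : ℕ) where
  f : Π x : M, TangentSpace 𝓘(ℝ, E) x →L[ℝ] TangentSpace 𝓘(ℝ, E) x
  ξ : Fin s → Π x : M, TangentSpace 𝓘(ℝ, E) x
  η : Fin s → Π x : M, TangentSpace 𝓘(ℝ, E) x →L[ℝ] ℝ
  smooth_f : ContMDiff 𝓘(ℝ, E) (𝓘(ℝ, E).prod 𝓘(ℝ, E →L[ℝ] E)) ∞
    (fun x ↦ TotalSpace.mk' (E →L[ℝ] E)
      (E := fun x : M ↦ TangentSpace 𝓘(ℝ, E) x →L[ℝ] TangentSpace 𝓘(ℝ, E) x) x (f x))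
  smooth_ξ : ∀ α, ContMDiff 𝓘(ℝ, E) (𝓘(ℝ, E).prod 𝓘(ℝ, E)) ∞
    (fun x ↦ TotalSpace.mk' E (E := fun x : M ↦ TangentSpace 𝓘(ℝ, E) x) x (ξ α x))
  smooth_η : ∀ α, ContMDiff 𝓘(ℝ, E) (𝓘(ℝ, E).prod 𝓘(ℝ, E →L[ℝ] ℝ)) ∞
    (fun x ↦ TotalSpace.mk' (E →L[ℝ] ℝ)
      (E := fun x : M ↦ TangentSpace 𝓘(ℝ, E) x →L[ℝ] ℝ) x (η α x))
  f_f : ∀ x u, f x (f x u) = - u + ∑ α, η α x u • ξ α x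
  η_ξ : ∀ x α β, η α x (ξ β x) = if α = β then 1 else 0
  f_ξ : ∀ x α, f x (ξ α x) = 0
  η_f : ∀ x α u, η α x (f x u) = 0
  inner_f_f : ∀ x u v, g.inner x (f x u) (f x v) = g.inner x u v - ∑ α, η α x u * η α x v

/-- The exterior derivative of a `1`-form `θ`, with the normalization
`2 dθ(X, Y) = X (θ(Y)) - Y (θ(X)) - θ([X, Y])`. -/
def extDerivOneForm (θ : Π x : M, TangentSpace 𝓘(ℝ, E) x →L[ℝ] ℝ)
    (X Y : Π x : M, TangentSpace 𝓘(ℝ, E) x) (x : M) : ℝ :=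
  (1 / 2 : ℝ) *
    (mvfderiv 𝓘(ℝ, E) (fun y ↦ θ y (Y y)) x (X x) - mvfderiv 𝓘(ℝ, E) (fun y ↦ θ y (X y)) x (Y x)
      - θ x (mlieBracket 𝓘(ℝ, E) X Y x))

/-- The Nijenhuis torsion
`[f, f](X, Y) = f² [X, Y] + [f X, f Y] - f [f X, Y] - f [X, f Y]` of a `(1, 1)` tensor field. -/
def nijenhuis (f : Π x : M, TangentSpace 𝓘(ℝ, E) x →L[ℝ] TangentSpace 𝓘(ℝ, E) x)
    (X Y : Π x : M, TangentSpace 𝓘(ℝ, E) x) (x : M) : TangentSpace 𝓘(ℝ, E) x :=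
  f x (f x (mlieBracket 𝓘(ℝ, E) X Y x))
    + mlieBracket 𝓘(ℝ, E) (fun y ↦ f y (X y)) (fun y ↦ f y (Y y)) x
    - f x (mlieBracket 𝓘(ℝ, E) (fun y ↦ f y (X y)) Y x)
    - f x (mlieBracket 𝓘(ℝ, E) X (fun y ↦ f y (Y y)) x)

namespace MetricFStructure

variable {g} {s : ℕ} (S : MetricFStructure g s)

/-- The fundamental `2`-form `Φ(u, v) = g (u, f v)`. -/
def fundamentalForm (x : M) (u v : TangentSpace 𝓘(ℝ, E) x) : ℝ := g.inner x u (S.f x v)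

/-- Normality: `[f, f] + 2 ∑ α, dη α ⊗ ξ α = 0`. The left-hand side is a tensor, so that it does not
matter whether it is tested on smooth vector fields or on those differentiable at `x`. -/
def IsNormal : Prop :=
  ∀ (x : M) (X Y : Π x : M, TangentSpace 𝓘(ℝ, E) x), MDiffAt (T% X) x → MDiffAt (T% Y) x →
    nijenhuis S.f X Y x + (2 : ℝ) • ∑ α, extDerivOneForm (S.η α) X Y x • S.ξ α x = 0

/-- An `S`-structure: a normal metric `f`-structure with `dη α = Φ` for all `α`. As soon as `s ≥ 1`
this implies that `Φ` is closed and, if `dim M = 2 n + s`, that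
`η 1 ∧ ⋯ ∧ η s ∧ (dη α) ^ n` vanishes nowhere. -/
structure IsS : Prop where
  normal : S.IsNormal
  extDeriv_η : ∀ (α : Fin s) (x : M) (X Y : Π x : M, TangentSpace 𝓘(ℝ, E) x),
    MDiffAt (T% X) x → MDiffAt (T% Y) x →
      extDerivOneForm (S.η α) X Y x = S.fundamentalForm x (X x) (Y x)

/-- The fibre at `x` of the distribution `𝓛`, the orthogonal complement of the structure vector
fields. -/
def distL (x : M) : Set (TangentSpace 𝓘(ℝ, E) x) := {u | ∀ α, g.inner x u (S.ξ α x) = 0}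

/-- The `𝓛`-sectional curvature of the Levi-Civita connection is constant, equal to `c`:
`K(u, v) = c` for every plane in `𝓛` and every basis `u`, `v` of it. -/
def HasConstantLSectionalCurvature (c : ℝ) : Prop :=
  ∀ (x : M) (u v : TangentSpace 𝓘(ℝ, E) x), u ∈ S.distL x → v ∈ S.distL x →
    LinearIndependent ℝ ![u, v] → sectionalCurvature g x u v = c

end MetricFStructure

end

end SManifold

namespace SManifold

noncomputable section

open Filter Topology

variable {E : Type*} [NormedAddCommGroup E] [NormedSpace ℝ E] [FiniteDimensional ℝ E]
  {M : Type*} [TopologicalSpace M] [ChartedSpace E M] [IsManifold 𝓘(ℝ, E) ∞ M]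
  (g : ContMDiffRiemannianMetric 𝓘(ℝ, E) ∞ E (fun x : M ↦ TangentSpace 𝓘(ℝ, E) x))

/-! The curvature of an S-manifold is largely forced by its structure. Since dη^α = Φ and f ξ_α = 0,
each ξ_α preserves every η^β, hence Φ; by normality it preserves f, hence g, so it is Killing. As
dη^α = Φ gives the skew part of ∇ξ_α, it follows that ∇_v ξ_α = -f v (`leviCivita_ξ`). Closedness of
Φ, normality and the derivative of f² then determine ∇f as in Sasakian geometry: with ξ = Σ ξ_α and
η = Σ η^α, (∇_v f) w = g(fv, fw) ξ + η(w) f² v (`covDerivF_eq`). One more derivative, with ∇_v ξ =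
-s f v, yields the commutator of R(u, v) with f on 𝓛, carrying a factor s (`curvatureForm_f`).

If the 𝓛-sectional curvature is c, polarisation turns R on 𝓛 into c times the tensor of constant
curvature 1, whose commutator with f is the same expression with c in place of s. Testing on nonzero
u, v in 𝓛 with v orthogonal to u and fu gives c = s; such a pair exists because dim 𝓛 = 2n > 2.

Since R(u, v) ξ_α is explicit as well, every R(u, v, v, u) is known (`curvatureForm_sectional`):
planes in 𝓛 have curvature c, those spanned by some ξ_α and a vector of 𝓛 have 1, those spanned by
two ξ's have 0. Summing over an arbitrary orthonormal basis is matrix algebra with the projection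
onto 𝓛.

The general Riemannian facts this rests on (smoothness of ∇, tensoriality and symmetries of R) are
derived from the Koszul formula and the Jacobi identity. -/

theorem isManifold_minSmoothness_two : IsManifold 𝓘(ℝ, E) (minSmoothness ℝ 2) M :=
  IsManifold.of_le (n := ∞) (by simpa using ENat.LEInfty.out)

theorem isManifold_minSmoothness_three : IsManifold 𝓘(ℝ, E) (minSmoothness ℝ 3) M :=
  IsManifold.of_le (n := ∞) (by simpa using ENat.LEInfty.out)

attribute [local instance] isManifold_minSmoothness_two isManifold_minSmoothness_three

/-! ### Smooth fields: metric functions, brackets, directional derivatives. -/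

section Smooth

variable {x : M} {X Y Z W : Π x : M, TangentSpace 𝓘(ℝ, E) x} {φ : M → ℝ}

theorem eventually_mdiff (hX : CMDiffAt ∞ (T% X) x) : ∀ᶠ y in 𝓝 x, MDiffAt (T% X) y := by
  have h := (contMDiffAt_iff_contMDiffAt_nhds (n := 1) (by simp)).1 (hX.of_le (by simp))
  exact h.mono fun y hy ↦ hy.mdifferentiableAt (by simp)

theorem eventually_mdiff_fun (hφ : CMDiffAt ∞ φ x) : ∀ᶠ y in 𝓝 x, MDiffAt φ y := by
  have h := (contMDiffAt_iff_contMDiffAt_nhds (n := 1) (by simp)).1 (hφ.of_le (by simp))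
  exact h.mono fun y hy ↦ hy.mdifferentiableAt (by simp)

theorem smooth_mdiff (hX : CMDiffAt ∞ (T% X) x) : MDiffAt (T% X) x :=
  hX.mdifferentiableAt (by simp)

theorem smooth_mdiff_fun (hφ : CMDiffAt ∞ φ x) : MDiffAt φ x :=
  hφ.mdifferentiableAt (by simp)

theorem smooth_metricFun (hX : CMDiffAt ∞ (T% X) x) (hY : CMDiffAt ∞ (T% Y) x) :
    CMDiffAt ∞ (metricFun g X Y) x := by
  have : ContMDiffAt 𝓘(ℝ, E) (𝓘(ℝ, E).prod 𝓘(ℝ)) ∞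
      (fun m ↦ TotalSpace.mk' ℝ (E := Bundle.Trivial M ℝ) m (g.inner m (X m) (Y m))) x := by
    apply ContMDiffAt.clm_bundle_apply₂ (F₁ := E) (F₂ := E)
    · exact g.contMDiff.contMDiffAt
    · exact hX
    · exact hY
  simp only [contMDiffAt_totalSpace] at this
  exact this.2

theorem smooth_bracket (hX : CMDiffAt ∞ (T% X) x) (hY : CMDiffAt ∞ (T% Y) x) :
    CMDiffAt ∞ (T% (mlieBracket 𝓘(ℝ, E) X Y)) x :=
  haveI : IsManifold 𝓘(ℝ, E) (((⊤ : ℕ∞) : WithTop ℕ∞) + 1) M := inferInstanceAs (IsManifold 𝓘(ℝ, E) ∞ M)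
  ContMDiffAt.mlieBracket_vectorField (m := ⊤) (n := ⊤) hX hY (by simp)

theorem smooth_extend (v : TangentSpace 𝓘(ℝ, E) x) :
    CMDiffAt ∞ (T% (FiberBundle.extend E v)) x :=
  FiberBundle.contMDiffAt_extend ..

/-- The bracket does the work: [X, φV] = (Xφ) V + φ [X, V], and pairing with a field V that is
nonzero at `x` lets Xφ be solved for. The metric only serves for this pairing. -/
theorem smooth_deriv
    (g : ContMDiffRiemannianMetric 𝓘(ℝ, E) ∞ E (fun x : M ↦ TangentSpace 𝓘(ℝ, E) x))
    (hφ : CMDiffAt ∞ φ x) (hX : CMDiffAt ∞ (T% X) x) :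
    CMDiffAt ∞ (fun y ↦ mvfderiv 𝓘(ℝ, E) φ y (X y)) x := by
  -- In dimension 0 no nonzero V exists, but all vectors vanish.
  rcases subsingleton_or_nontrivial E with h | h
  · have : (fun y ↦ mvfderiv 𝓘(ℝ, E) φ y (X y)) = fun _ ↦ (0 : ℝ) := by
      funext y
      have : X y = 0 := Subsingleton.elim (α := E) _ _
      rw [this, map_zero]
    rw [this]
    exact contMDiffAt_const
  obtain ⟨v, hv⟩ := exists_ne (0 : E)
  set V : Π y : M, TangentSpace 𝓘(ℝ, E) y := FiberBundle.extend E (v : TangentSpace 𝓘(ℝ, E) x)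
  have hV : CMDiffAt ∞ (T% V) x := smooth_extend _
  have hVx : V x = v := FiberBundle.extend_apply_self ..
  have hφV : CMDiffAt ∞ (T% (φ • V)) x := hφ.smul_section hV
  have h0 : metricFun g V V x ≠ 0 := by
    have := g.pos x v hv
    simp only [metricFun, hVx]
    exact this.ne'
  have h1 : CMDiffAt ∞ (fun y ↦ (metricFun g (mlieBracket 𝓘(ℝ, E) X (φ • V)) V y
      - φ y * metricFun g (mlieBracket 𝓘(ℝ, E) X V) V y) / metricFun g V V y) x :=
    ((smooth_metricFun g (smooth_bracket hX hφV) hV).sub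
      (hφ.mul (smooth_metricFun g (smooth_bracket hX hV) hV))).div₀ (smooth_metricFun g hV hV) h0
  refine h1.congr_of_eventuallyEq ?_
  filter_upwards [eventually_mdiff hV, eventually_mdiff_fun hφ,
    (smooth_metricFun g hV hV).continuousAt.eventually_ne h0] with y hy1 hy2 hy3
  rw [eq_div_iff hy3]
  simp only [metricFun, mlieBracket_smul_right hy2 hy1, map_add, map_smul, add_apply, smul_apply,
    smul_eq_mul]
  ring

end Smooth

/-! ### Smoothness of the Levi-Civita connection. -/

section SmoothConnection

variable {x : M} {X Y Z W : Π x : M, TangentSpace 𝓘(ℝ, E) x} {φ : M → ℝ}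

theorem smooth_matrix_det {ι : Type*} [Fintype ι] [DecidableEq ι] {G : M → Matrix ι ι ℝ}
    (hG : ∀ i j, CMDiffAt ∞ (fun y ↦ G y i j) x) : CMDiffAt ∞ (fun y ↦ (G y).det) x := by
  simp only [Matrix.det_apply]
  refine ContMDiffAt.sum fun σ _ ↦ ?_
  have : CMDiffAt ∞ (fun y ↦ ∏ i, G y (σ i) i) x := contMDiffAt_finsetProd fun i _ ↦ hG _ _
  simp only [Units.smul_def, zsmul_eq_mul]
  exact contMDiffAt_const.mul this

theorem smooth_matrix_adjugate {ι : Type*} [Fintype ι] [DecidableEq ι] {G : M → Matrix ι ι ℝ}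
    (hG : ∀ i j, CMDiffAt ∞ (fun y ↦ G y i j) x) (i j : ι) :
    CMDiffAt ∞ (fun y ↦ (G y).adjugate i j) x := by
  simp only [Matrix.adjugate_apply]
  refine smooth_matrix_det fun k l ↦ ?_
  by_cases h : k = j
  · subst h
    simp only [Matrix.updateRow_self]
    exact contMDiffAt_const
  · simp only [Matrix.updateRow_ne h]
    exact hG k l

/-- A vector field is smooth as soon as its inner products with smooth vector fields are. -/
theorem smooth_of_metricFun {V : Π x : M, TangentSpace 𝓘(ℝ, E) x}
    (h : ∀ Z : Π x : M, TangentSpace 𝓘(ℝ, E) x, CMDiffAt ∞ (T% Z) x →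
      CMDiffAt ∞ (metricFun g V Z) x) : CMDiffAt ∞ (T% V) x := by
  classical
  let t := trivializationAt E (fun y : M ↦ TangentSpace 𝓘(ℝ, E) y) x
  have hx : x ∈ t.baseSet := FiberBundle.mem_baseSet_trivializationAt' x
  let b := Module.finBasis ℝ E
  let e := t.localFrame b
  have he (i) : CMDiffAt ∞ (T% (e i)) x := contMDiffAt_localFrame_of_mem ∞ t b i hx
  rw [contMDiffAt_iff_localFrameCoeff (I := 𝓘(ℝ, E)) (e := t) b hx]
  -- The Gram matrix of a local frame. A kernel vector would give a combination of the frame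
  -- orthogonal to itself, so G is invertible, and Cramer's rule recovers the coefficients of V from
  -- the functions g(V, e_i).
  let G : M → Matrix _ _ ℝ := fun y ↦ Matrix.of fun i j ↦ metricFun g (e i) (e j) y
  have hG : ∀ i j, CMDiffAt ∞ (fun y ↦ G y i j) x := fun i j ↦ smooth_metricFun g (he i) (he j)
  have hdet (y : M) (hy : y ∈ t.baseSet) : (G y).det ≠ 0 := by
    intro h0
    obtain ⟨a, ha, hGa⟩ := Matrix.exists_mulVec_eq_zero_iff.2 h0
    have h1 (i) : g.inner y (∑ j, a j • e j y) (e i y) = 0 := by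
      rw [g.symm y]
      have := congrFun hGa i
      simpa [Matrix.mulVec, dotProduct, G, metricFun, mul_comm] using this
    have h2 : ∑ j, a j • e j y = 0 := by
      by_contra hw
      have := g.pos y _ hw
      rw [map_sum (g.inner y _)] at this
      simp only [map_smul, h1, smul_zero, Finset.sum_const_zero, lt_irrefl] at this
    have h3 := (t.isLocalFrameOn_localFrame_baseSet 𝓘(ℝ, E) ∞ b).linearIndependent hy
    exact ha (funext (Fintype.linearIndependent_iff.1 h3 a h2))
  intro j
  have hsm : CMDiffAt ∞ (fun y ↦ (∑ i, metricFun g V (e i) y * (G y).adjugate i j) / (G y).det) x :=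
    (ContMDiffAt.sum fun i _ ↦ (h _ (he i)).mul (smooth_matrix_adjugate hG i j)).div₀
      (smooth_matrix_det hG) (hdet x hx)
  refine hsm.congr_of_eventuallyEq ?_
  filter_upwards [t.open_baseSet.mem_nhds hx] with y hy
  rw [eq_div_iff (hdet y hy)]
  have hV := t.eq_sum_localFrameCoeff_smul (I := 𝓘(ℝ, E)) (b := b) (s := V) hy
  set c : _ → ℝ := fun i ↦ t.localFrameCoeff 𝓘(ℝ, E) b i y (V y) with hc
  have h1 : (fun i ↦ metricFun g V (e i) y) = Matrix.vecMul c (G y) := by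
    funext i
    simp only [metricFun]
    rw [hV, map_sum, _root_.sum_apply]
    simp [Matrix.vecMul, dotProduct, G, metricFun, c, e]
  have h2 : Matrix.vecMul (fun i ↦ metricFun g V (e i) y) (G y).adjugate = (G y).det • c := by
    rw [h1, Matrix.vecMul_vecMul, Matrix.mul_adjugate, Matrix.vecMul_smul, Matrix.vecMul_one]
  have h3 := congrFun h2 j
  simp only [Matrix.vecMul, dotProduct, Pi.smul_apply, smul_eq_mul] at h3
  rw [h3, mul_comm]
  rfl

theorem smooth_koszul (hX : CMDiffAt ∞ (T% X) x) (hY : CMDiffAt ∞ (T% Y) x)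
    (hZ : CMDiffAt ∞ (T% Z) x) : CMDiffAt ∞ (koszul g Y X Z) x := by
  have h1 := smooth_deriv g (smooth_metricFun g hY hZ) hX
  have h2 := smooth_deriv g (smooth_metricFun g hX hZ) hY
  have h3 := smooth_deriv g (smooth_metricFun g hX hY) hZ
  have h4 := smooth_metricFun g (smooth_bracket hX hY) hZ
  have h5 := smooth_metricFun g (smooth_bracket hX hZ) hY
  have h6 := smooth_metricFun g (smooth_bracket hY hZ) hX
  exact contMDiffAt_const.mul (((((h1.add h2).sub h3).add h4).sub h5).sub h6)

/-- Tested against a smooth Z, the derivative becomes the Koszul expression near `x`, which is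
smooth. -/
theorem smooth_leviCivita (hX : CMDiffAt ∞ (T% X) x) (hY : CMDiffAt ∞ (T% Y) x) :
    CMDiffAt ∞ (T% (fun y ↦ leviCivita g Y y (X y))) x := by
  refine smooth_of_metricFun g fun Z hZ ↦ (smooth_koszul g hX hY hZ).congr_of_eventuallyEq ?_
  filter_upwards [eventually_mdiff hX, eventually_mdiff hY, eventually_mdiff hZ] with y h1 h2 h3
  exact inner_leviCivita g h1 h2 h3

/-- The Lie bracket acts on functions as the commutator of derivations. -/
theorem mvfderiv_mlieBracket
    (g : ContMDiffRiemannianMetric 𝓘(ℝ, E) ∞ E (fun x : M ↦ TangentSpace 𝓘(ℝ, E) x))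
    (hX : CMDiffAt ∞ (T% X) x) (hY : CMDiffAt ∞ (T% Y) x) (hφ : CMDiffAt ∞ φ x) :
    mvfderiv 𝓘(ℝ, E) φ x (mlieBracket 𝓘(ℝ, E) X Y x)
      = mvfderiv 𝓘(ℝ, E) (fun y ↦ mvfderiv 𝓘(ℝ, E) φ y (Y y)) x (X x)
        - mvfderiv 𝓘(ℝ, E) (fun y ↦ mvfderiv 𝓘(ℝ, E) φ y (X y)) x (Y x) := by
  rcases subsingleton_or_nontrivial E with h | h
  · have h0 (Z : Π x : M, TangentSpace 𝓘(ℝ, E) x) : Z x = 0 := Subsingleton.elim (α := E) _ _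
    rw [h0 X, h0 Y, h0 (mlieBracket 𝓘(ℝ, E) X Y)]
    simp
  obtain ⟨v, hv⟩ := exists_ne (0 : E)
  set V : Π y : M, TangentSpace 𝓘(ℝ, E) y := FiberBundle.extend E (v : TangentSpace 𝓘(ℝ, E) x)
  have hV : CMDiffAt ∞ (T% V) x := smooth_extend _
  have hVx : V x = v := FiberBundle.extend_apply_self ..
  -- The coefficient of V in the Jacobi identity for X, Y, φV is the claim: the mixed terms are
  -- symmetric in X and Y, and the rest is φ times the Jacobi identity for X, Y, V.
  have key {X Y : Π x : M, TangentSpace 𝓘(ℝ, E) x} (hX : CMDiffAt ∞ (T% X) x)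
      (hY : CMDiffAt ∞ (T% Y) x) :
      mlieBracket 𝓘(ℝ, E) X (mlieBracket 𝓘(ℝ, E) Y (φ • V)) x
        = mvfderiv 𝓘(ℝ, E) (fun y ↦ mvfderiv 𝓘(ℝ, E) φ y (Y y)) x (X x) • V x
          + mvfderiv 𝓘(ℝ, E) φ x (Y x) • mlieBracket 𝓘(ℝ, E) X V x
          + mvfderiv 𝓘(ℝ, E) φ x (X x) • mlieBracket 𝓘(ℝ, E) Y V x
          + φ x • mlieBracket 𝓘(ℝ, E) X (mlieBracket 𝓘(ℝ, E) Y V) x := by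
    have hYφ := smooth_deriv g hφ hY
    have h1 : mlieBracket 𝓘(ℝ, E) Y (φ • V) =ᶠ[𝓝 x]
        ((fun y ↦ mvfderiv 𝓘(ℝ, E) φ y (Y y)) • V + φ • mlieBracket 𝓘(ℝ, E) Y V) := by
      filter_upwards [eventually_mdiff hV, eventually_mdiff_fun hφ] with y hy1 hy2
      rw [mlieBracket_smul_right hy2 hy1]
      rfl
    have h2 := smooth_mdiff (smooth_bracket hY hV)
    rw [(EventuallyEq.refl _ X).mlieBracket_vectorField_eq h1,
      mlieBracket_add_right ((smooth_mdiff_fun hYφ).smul_section (smooth_mdiff hV))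
        ((smooth_mdiff_fun hφ).smul_section h2),
      mlieBracket_smul_right (smooth_mdiff_fun hYφ) (smooth_mdiff hV),
      mlieBracket_smul_right (smooth_mdiff_fun hφ) h2]
    abel
  have hφV : CMDiffAt ∞ (T% (φ • V)) x := hφ.smul_section hV
  have le2 : minSmoothness ℝ 2 ≤ ∞ := by simpa using ENat.LEInfty.out
  have J1 := leibniz_identity_mlieBracket_apply (hX.of_le le2) (hY.of_le le2) (hφV.of_le le2)
  have J2 := leibniz_identity_mlieBracket_apply (hX.of_le le2) (hY.of_le le2) (hV.of_le le2)
  rw [key hX hY, key hY hX, mlieBracket_smul_right (smooth_mdiff_fun hφ) (smooth_mdiff hV), J2] at J1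
  have h3 : (mvfderiv 𝓘(ℝ, E) (fun y ↦ mvfderiv 𝓘(ℝ, E) φ y (Y y)) x (X x)
        - mvfderiv 𝓘(ℝ, E) (fun y ↦ mvfderiv 𝓘(ℝ, E) φ y (X y)) x (Y x)
        - mvfderiv 𝓘(ℝ, E) φ x (mlieBracket 𝓘(ℝ, E) X Y x)) • V x = 0 := by
    rw [← sub_eq_zero] at J1
    rw [← J1]
    module
  rw [smul_eq_zero, or_iff_left (by rw [hVx]; exact hv)] at h3
  linarith

end SmoothConnection

/-! ### Function-linearity and symmetries of the curvature of fields. -/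

section Curvature

variable {x : M} {X X' Y Y' Z Z' W : Π x : M, TangentSpace 𝓘(ℝ, E) x} {φ : M → ℝ}

theorem mvfderiv_congr {φ ψ : M → ℝ} (h : φ =ᶠ[𝓝 x] ψ) :
    mvfderiv 𝓘(ℝ, E) φ x = mvfderiv 𝓘(ℝ, E) ψ x := by
  ext v
  exact congrArg (fun L : E →L[ℝ] ℝ ↦ L v) (h.mfderiv_eq (I := 𝓘(ℝ, E)) (I' := 𝓘(ℝ, ℝ)))

theorem leviCivita_add (hX : MDiffAt (T% X) x) (hY : MDiffAt (T% Y) x)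
    (v : TangentSpace 𝓘(ℝ, E) x) :
    leviCivita g (X + Y) x v = leviCivita g X x v + leviCivita g Y x v := by
  rw [(leviCivita g).isCovariantDerivativeOnUniv.add hX hY]
  rfl

theorem leviCivita_smul (hφ : MDiffAt φ x) (hX : MDiffAt (T% X) x)
    (v : TangentSpace 𝓘(ℝ, E) x) :
    leviCivita g (φ • X) x v = φ x • leviCivita g X x v + mvfderiv 𝓘(ℝ, E) φ x v • X x := by
  rw [(leviCivita g).isCovariantDerivativeOnUniv.leibniz hX hφ]
  rfl

theorem leviCivita_neg (hX : MDiffAt (T% X) x) (v : TangentSpace 𝓘(ℝ, E) x) :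
    leviCivita g (-X) x v = -leviCivita g X x v := by
  have h := (leviCivita g).isCovariantDerivativeOnUniv.smul_const (-1) hX
  rw [neg_one_smul, neg_one_smul] at h
  rw [h]
  rfl

theorem leviCivita_zero (v : TangentSpace 𝓘(ℝ, E) x) : leviCivita g 0 x v = 0 := by
  rw [CovariantDerivative.zero]
  rfl

theorem leviCivita_congr (hX : MDiffAt (T% X) x) (h : X =ᶠ[𝓝 x] Y) :
    leviCivita g X x = leviCivita g Y x := by
  refine (leviCivita g).isCovariantDerivativeOnUniv.congr_of_eventuallyEq hX ?_ univ_mem h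
  refine hX.congr_of_eventuallyEq ?_
  filter_upwards [h] with y hy
  rw [hy]

theorem leviCivita_sum {ι : Type*} (s : Finset ι) {X : ι → Π x : M, TangentSpace 𝓘(ℝ, E) x}
    (hX : ∀ i, MDiffAt (T% (X i)) x) (v : TangentSpace 𝓘(ℝ, E) x) :
    leviCivita g (fun y ↦ ∑ i ∈ s, X i y) x v = ∑ i ∈ s, leviCivita g (X i) x v := by
  classical
  induction s using Finset.induction_on with
  | empty =>
    simp only [Finset.sum_empty]
    exact leviCivita_zero g v
  | insert a s ha ih =>
    simp only [Finset.sum_insert ha]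
    rw [← ih]
    exact leviCivita_add g (hX a) (.sum_section fun i _ ↦ hX i) v

theorem mlieBracket_eq_leviCivita (hX : MDiffAt (T% X) x) (hY : MDiffAt (T% Y) x) :
    mlieBracket 𝓘(ℝ, E) X Y x = leviCivita g Y x (X x) - leviCivita g X x (Y x) :=
  (((leviCivita g).torsion_eq_zero_iff.1 (leviCivita_torsion g)) hX hY).symm

theorem curvatureField_swap : curvatureField g X Y Z x = -curvatureField g Y X Z x := by
  simp only [curvatureField, mlieBracket_swap_apply (V := X) (W := Y), map_neg]
  abel

theorem curvatureField_add_left (hX : CMDiffAt ∞ (T% X) x) (hX' : CMDiffAt ∞ (T% X') x)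
    (hZ : CMDiffAt ∞ (T% Z) x) :
    curvatureField g (X + X') Y Z x = curvatureField g X Y Z x + curvatureField g X' Y Z x := by
  have h1 : (fun y ↦ leviCivita g Z y ((X + X') y))
      = (fun y ↦ leviCivita g Z y (X y)) + fun y ↦ leviCivita g Z y (X' y) := by
    funext y
    simp
  simp only [curvatureField]
  rw [h1, mlieBracket_add_left (smooth_mdiff hX) (smooth_mdiff hX'),
    leviCivita_add g (smooth_mdiff (smooth_leviCivita g hX hZ))
      (smooth_mdiff (smooth_leviCivita g hX' hZ)), Pi.add_apply, map_add, map_add]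
  abel

theorem curvatureField_smul_left (hφ : CMDiffAt ∞ φ x) (hX : CMDiffAt ∞ (T% X) x)
    (hZ : CMDiffAt ∞ (T% Z) x) :
    curvatureField g (φ • X) Y Z x = φ x • curvatureField g X Y Z x := by
  have h1 : (fun y ↦ leviCivita g Z y ((φ • X) y)) = φ • fun y ↦ leviCivita g Z y (X y) := by
    funext y
    simp
  simp only [curvatureField]
  rw [h1, mlieBracket_smul_left (smooth_mdiff_fun hφ) (smooth_mdiff hX),
    leviCivita_smul g (smooth_mdiff_fun hφ) (smooth_mdiff (smooth_leviCivita g hX hZ))]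
  simp only [Pi.smul_apply', map_add, map_smul, neg_smul, map_neg]
  module

theorem curvatureField_add (hX : CMDiffAt ∞ (T% X) x) (hY : CMDiffAt ∞ (T% Y) x)
    (hZ : CMDiffAt ∞ (T% Z) x) (hZ' : CMDiffAt ∞ (T% Z') x) :
    curvatureField g X Y (Z + Z') x = curvatureField g X Y Z x + curvatureField g X Y Z' x := by
  have key {X Y : Π x : M, TangentSpace 𝓘(ℝ, E) x} (hY : CMDiffAt ∞ (T% Y) x) :
      leviCivita g (fun y ↦ leviCivita g (Z + Z') y (Y y)) x (X x)
        = leviCivita g (fun y ↦ leviCivita g Z y (Y y)) x (X x)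
          + leviCivita g (fun y ↦ leviCivita g Z' y (Y y)) x (X x) := by
    rw [← leviCivita_add g (smooth_mdiff (smooth_leviCivita g hY hZ))
      (smooth_mdiff (smooth_leviCivita g hY hZ')),
      leviCivita_congr g (smooth_mdiff (smooth_leviCivita g hY (hZ.add_section hZ')))]
    filter_upwards [eventually_mdiff hZ, eventually_mdiff hZ'] with y h1 h2
    exact leviCivita_add g h1 h2 _
  simp only [curvatureField, key hX, key hY, leviCivita_add g (smooth_mdiff hZ) (smooth_mdiff hZ')]
  abel

/-- First derivatives of φ enter symmetrically in X and Y; the second ones leave (X(Yφ) - Y(Xφ)) Z,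
which the term ([X, Y]φ) Z of ∇_[X, Y] cancels. -/
theorem curvatureField_smul (hφ : CMDiffAt ∞ φ x) (hX : CMDiffAt ∞ (T% X) x)
    (hY : CMDiffAt ∞ (T% Y) x) (hZ : CMDiffAt ∞ (T% Z) x) :
    curvatureField g X Y (φ • Z) x = φ x • curvatureField g X Y Z x := by
  have key {X Y : Π x : M, TangentSpace 𝓘(ℝ, E) x} (hY : CMDiffAt ∞ (T% Y) x) :
      leviCivita g (fun y ↦ leviCivita g (φ • Z) y (Y y)) x (X x)
        = φ x • leviCivita g (fun y ↦ leviCivita g Z y (Y y)) x (X x)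
          + mvfderiv 𝓘(ℝ, E) φ x (X x) • leviCivita g Z x (Y x)
          + mvfderiv 𝓘(ℝ, E) φ x (Y x) • leviCivita g Z x (X x)
          + mvfderiv 𝓘(ℝ, E) (fun y ↦ mvfderiv 𝓘(ℝ, E) φ y (Y y)) x (X x) • Z x := by
    have h1 := smooth_leviCivita g hY hZ
    have h2 := smooth_deriv g hφ hY
    rw [leviCivita_congr g
      (Y := φ • (fun y ↦ leviCivita g Z y (Y y)) + (fun y ↦ mvfderiv 𝓘(ℝ, E) φ y (Y y)) • Z)
      (smooth_mdiff (smooth_leviCivita g hY (hφ.smul_section hZ))),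
      leviCivita_add g ((smooth_mdiff_fun hφ).smul_section (smooth_mdiff h1))
        ((smooth_mdiff_fun h2).smul_section (smooth_mdiff hZ)),
      leviCivita_smul g (smooth_mdiff_fun hφ) (smooth_mdiff h1),
      leviCivita_smul g (smooth_mdiff_fun h2) (smooth_mdiff hZ)]
    · abel
    filter_upwards [eventually_mdiff hZ, eventually_mdiff_fun hφ] with y h1 h2
    exact leviCivita_smul g h2 h1 _
  simp only [curvatureField, key hX, key hY,
    leviCivita_smul g (smooth_mdiff_fun hφ) (smooth_mdiff hZ), mvfderiv_mlieBracket g hX hY hφ]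
  module

/-- First Bianchi identity. -/
theorem curvatureField_bianchi (hX : CMDiffAt ∞ (T% X) x) (hY : CMDiffAt ∞ (T% Y) x)
    (hZ : CMDiffAt ∞ (T% Z) x) :
    curvatureField g X Y Z x + curvatureField g Y Z X x + curvatureField g Z X Y x = 0 := by
  -- Zero torsion writes each double bracket through ∇, so the Jacobi identity becomes the cyclic
  -- sum of curvatures.
  have key {X Y Z : Π x : M, TangentSpace 𝓘(ℝ, E) x} (hX : CMDiffAt ∞ (T% X) x)
      (hY : CMDiffAt ∞ (T% Y) x) (hZ : CMDiffAt ∞ (T% Z) x) :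
      mlieBracket 𝓘(ℝ, E) X (mlieBracket 𝓘(ℝ, E) Y Z) x
        = leviCivita g (fun y ↦ leviCivita g Z y (Y y)) x (X x)
          - leviCivita g (fun y ↦ leviCivita g Y y (Z y)) x (X x)
          - leviCivita g X x (mlieBracket 𝓘(ℝ, E) Y Z x) := by
    have h1 := smooth_leviCivita g hY hZ
    have h2 := smooth_leviCivita g hZ hY
    rw [mlieBracket_eq_leviCivita g (smooth_mdiff hX) (smooth_mdiff (smooth_bracket hY hZ)),
      leviCivita_congr g
      (Y := (fun y ↦ leviCivita g Z y (Y y)) + -(fun y ↦ leviCivita g Y y (Z y)))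
      (smooth_mdiff (smooth_bracket hY hZ)),
      leviCivita_add g (smooth_mdiff h1) (smooth_mdiff h2.neg_section),
      leviCivita_neg g (smooth_mdiff h2), ← sub_eq_add_neg]
    filter_upwards [eventually_mdiff hY, eventually_mdiff hZ] with y h1 h2
    rw [mlieBracket_eq_leviCivita g h1 h2, sub_eq_add_neg]
    rfl
  have le2 : minSmoothness ℝ 2 ≤ ∞ := by simpa using ENat.LEInfty.out
  have J := leibniz_identity_mlieBracket_apply (hX.of_le le2) (hY.of_le le2) (hZ.of_le le2)
  rw [mlieBracket_swap_apply (V := mlieBracket 𝓘(ℝ, E) X Y),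
    mlieBracket_swap (V := X) (W := Z)] at J
  have hneg : mlieBracket 𝓘(ℝ, E) Y (-mlieBracket 𝓘(ℝ, E) Z X) x
      = -mlieBracket 𝓘(ℝ, E) Y (mlieBracket 𝓘(ℝ, E) Z X) x := by
    have := mlieBracket_const_smul_right (𝕜 := ℝ) (I := 𝓘(ℝ, E)) (V := Y) (c := -1)
      (smooth_mdiff (smooth_bracket hZ hX))
    simpa using this
  rw [hneg, key hX hY hZ, key hY hZ hX, key hZ hX hY] at J
  simp only [curvatureField]
  rw [← sub_eq_zero] at J
  rw [← J]
  abel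

/-- Apply X, Y and [X, Y] to the function g(Z, W) using metricity: the products of first derivatives
are symmetric in X and Y and drop out of the commutator. -/
theorem inner_curvatureField_swap (hX : CMDiffAt ∞ (T% X) x) (hY : CMDiffAt ∞ (T% Y) x)
    (hZ : CMDiffAt ∞ (T% Z) x) (hW : CMDiffAt ∞ (T% W) x) :
    g.inner x (curvatureField g X Y Z x) (W x) = -g.inner x (curvatureField g X Y W x) (Z x) := by
  have key {X Y : Π x : M, TangentSpace 𝓘(ℝ, E) x} (hX : CMDiffAt ∞ (T% X) x)
      (hY : CMDiffAt ∞ (T% Y) x) :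
      mvfderiv 𝓘(ℝ, E) (fun y ↦ mvfderiv 𝓘(ℝ, E) (metricFun g Z W) y (Y y)) x (X x)
        = g.inner x (leviCivita g (fun y ↦ leviCivita g Z y (Y y)) x (X x)) (W x)
          + g.inner x (leviCivita g Z x (Y x)) (leviCivita g W x (X x))
          + g.inner x (leviCivita g Z x (X x)) (leviCivita g W x (Y x))
          + g.inner x (Z x) (leviCivita g (fun y ↦ leviCivita g W y (Y y)) x (X x)) := by
    have h1 := smooth_leviCivita g hY hZ
    have h2 := smooth_leviCivita g hY hW
    have h3 : (fun y ↦ mvfderiv 𝓘(ℝ, E) (metricFun g Z W) y (Y y)) =ᶠ[𝓝 x]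
        (metricFun g (fun y ↦ leviCivita g Z y (Y y)) W
          + metricFun g Z (fun y ↦ leviCivita g W y (Y y))) := by
      filter_upwards [eventually_mdiff hY, eventually_mdiff hZ, eventually_mdiff hW] with y a b c
      rw [leviCivita_metric g a b c]
      rfl
    have h4 : mvfderiv 𝓘(ℝ, E) (fun y ↦ mvfderiv 𝓘(ℝ, E) (metricFun g Z W) y (Y y)) x
        = mvfderiv 𝓘(ℝ, E) (metricFun g (fun y ↦ leviCivita g Z y (Y y)) W
          + metricFun g Z (fun y ↦ leviCivita g W y (Y y))) x := mvfderiv_congr h3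
    rw [h4, mvfderiv_add (smooth_mdiff_fun (smooth_metricFun g h1 hW))
      (smooth_mdiff_fun (smooth_metricFun g hZ h2)), add_apply,
      leviCivita_metric g (smooth_mdiff hX) (smooth_mdiff h1) (smooth_mdiff hW),
      leviCivita_metric g (smooth_mdiff hX) (smooth_mdiff hZ) (smooth_mdiff h2)]
    ring
  have h := mvfderiv_mlieBracket g hX hY (smooth_metricFun g hZ hW)
  rw [key hX hY, key hY hX, leviCivita_metric g (smooth_mdiff (smooth_bracket hX hY))
    (smooth_mdiff hZ) (smooth_mdiff hW)] at h
  simp only [curvatureField, map_sub, sub_apply, g.symm x _ (Z x)]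
  linarith

end Curvature

/-! ### Tensoriality on smooth fields; two derivatives rule out fields merely differentiable at the
point. -/

section Tensoriality

variable {x : M} {X Y Z W : Π x : M, TangentSpace 𝓘(ℝ, E) x}

/-- An operation on vector fields is tensorial at `x` on smooth fields if it is additive and
homogeneous over functions on the vector fields that are smooth at `x`. -/
structure SmoothTensorialAt {A : Type*} [AddCommGroup A] [Module ℝ A]
    (Ψ : (Π x : M, TangentSpace 𝓘(ℝ, E) x) → A) (x : M) : Prop where
  smul : ∀ {φ : M → ℝ} {X : Π x : M, TangentSpace 𝓘(ℝ, E) x},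
    CMDiffAt ∞ φ x → CMDiffAt ∞ (T% X) x → Ψ (φ • X) = φ x • Ψ X
  add : ∀ {X Y : Π x : M, TangentSpace 𝓘(ℝ, E) x},
    CMDiffAt ∞ (T% X) x → CMDiffAt ∞ (T% Y) x → Ψ (X + Y) = Ψ X + Ψ Y

namespace SmoothTensorialAt

variable {A : Type*} [AddCommGroup A] [Module ℝ A]
  {Ψ : (Π x : M, TangentSpace 𝓘(ℝ, E) x) → A}

theorem congr_germ (h : SmoothTensorialAt Ψ x) (hX : CMDiffAt ∞ (T% X) x)
    (hY : CMDiffAt ∞ (T% Y) x) (hXY : ∀ᶠ y in 𝓝 x, X y = Y y) : Ψ X = Ψ Y := by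
  classical
  -- The indicator of the set where X = Y is constant 1 near `x`, hence smooth there, and makes ψX
  -- and ψY equal globally; no bump function is needed.
  let ψ (y : M) : ℝ := if X y = Y y then 1 else 0
  have hψx : ψ x = 1 := by simp [ψ, hXY.self_of_nhds]
  have hXY' : ψ • X = ψ • Y := by
    funext y
    by_cases hy : X y = Y y <;> simp [ψ, hy]
  have hψ : CMDiffAt ∞ ψ x := by
    have h1 : CMDiffAt ∞ (fun _ : M ↦ (1 : ℝ)) x := contMDiffAt_const
    exact h1.congr_of_eventuallyEq (hXY.mono fun y hy ↦ by simp [ψ, hy])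
  calc Ψ X = Ψ (ψ • X) := by rw [h.smul hψ hX, hψx, one_smul]
    _ = Ψ (ψ • Y) := by rw [hXY']
    _ = Ψ Y := by rw [h.smul hψ hY, hψx, one_smul]

theorem sum (h : SmoothTensorialAt Ψ x) {ι : Type*} {s : Finset ι}
    (X : ι → Π x : M, TangentSpace 𝓘(ℝ, E) x) (hX : ∀ i, CMDiffAt ∞ (T% (X i)) x) :
    Ψ (fun y ↦ ∑ i ∈ s, X i y) = ∑ i ∈ s, Ψ (X i) := by
  classical
  induction s using Finset.induction_on with
  | empty =>
    have h0 : (fun y : M ↦ ∑ i ∈ (∅ : Finset ι), X i y) = (fun _ : M ↦ (0 : ℝ)) • FiberBundle.extend E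
        (0 : TangentSpace 𝓘(ℝ, E) x) := by
      funext y
      simp
    rw [h0, h.smul contMDiffAt_const (smooth_extend _)]
    simp
  | insert a s ha ih =>
    simp only [Finset.sum_insert ha]
    rw [← ih]
    exact h.add (hX a) (.sum_section fun i _ ↦ hX i)

/-- Expanding in a local frame near `x`, the value depends only on the coefficients at `x`. -/
theorem pointwise (h : SmoothTensorialAt Ψ x) (hX : CMDiffAt ∞ (T% X) x)
    (hY : CMDiffAt ∞ (T% Y) x) (hXY : X x = Y x) : Ψ X = Ψ Y := by
  let t := trivializationAt E (fun y : M ↦ TangentSpace 𝓘(ℝ, E) y) x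
  have hx : x ∈ t.baseSet := FiberBundle.mem_baseSet_trivializationAt' x
  let b := Module.finBasis ℝ E
  let e := t.localFrame b
  let c := t.localFrameCoeff 𝓘(ℝ, E) b
  have he (i) : CMDiffAt ∞ (T% (e i)) x := contMDiffAt_localFrame_of_mem ∞ t b i hx
  have hc {X : Π x : M, TangentSpace 𝓘(ℝ, E) x} (hX : CMDiffAt ∞ (T% X) x) (i) :
      CMDiffAt ∞ (LinearMap.piApply (c i) X) x := contMDiffAt_localFrameCoeff b hx hX i
  have key {X : Π x : M, TangentSpace 𝓘(ℝ, E) x} (hX : CMDiffAt ∞ (T% X) x) :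
      Ψ X = ∑ i, c i x (X x) • Ψ (e i) := by
    rw [h.congr_germ hX (.sum_section fun i _ ↦ (hc hX i).smul_section (he i))
      (t.eventually_eq_localFrame_sum_coeff_smul b hx),
      h.sum _ fun i ↦ (hc hX i).smul_section (he i)]
    exact Finset.sum_congr rfl fun i _ ↦ h.smul (hc hX i) (he i)
  rw [key hX, key hY, hXY]

end SmoothTensorialAt

/-- The curvature is a tensor. -/
theorem curvature_apply (hX : CMDiffAt ∞ (T% X) x) (hY : CMDiffAt ∞ (T% Y) x)
    (hZ : CMDiffAt ∞ (T% Z) x) :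
    curvature g x (X x) (Y x) (Z x) = curvatureField g X Y Z x := by
  have h1 {Y Z : Π x : M, TangentSpace 𝓘(ℝ, E) x} (hZ : CMDiffAt ∞ (T% Z) x) :
      SmoothTensorialAt (fun X ↦ curvatureField g X Y Z x) x :=
    ⟨fun hφ hX ↦ curvatureField_smul_left g hφ hX hZ,
      fun hX hX' ↦ curvatureField_add_left g hX hX' hZ⟩
  have h3 {X Y : Π x : M, TangentSpace 𝓘(ℝ, E) x} (hX : CMDiffAt ∞ (T% X) x)
      (hY : CMDiffAt ∞ (T% Y) x) : SmoothTensorialAt (fun Z ↦ curvatureField g X Y Z x) x :=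
    ⟨fun hφ hZ ↦ curvatureField_smul g hφ hX hY hZ,
      fun hZ hZ' ↦ curvatureField_add g hX hY hZ hZ'⟩
  have eX := smooth_extend (X x)
  have eY := smooth_extend (Y x)
  have eZ := smooth_extend (Z x)
  have p1 := (h1 (Y := FiberBundle.extend E (Y x)) eZ).pointwise eX hX
    (FiberBundle.extend_apply_self ..)
  have p2 := (h1 (Y := X) eZ).pointwise eY hY (FiberBundle.extend_apply_self ..)
  have p3 := (h3 hX hY).pointwise eZ hZ (FiberBundle.extend_apply_self ..)
  -- The second slot is reduced to the first by skew-symmetry.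
  rw [curvature, p1, curvatureField_swap, p2, ← curvatureField_swap, p3]

end Tensoriality

/-! ### Algebraic curvature tensors. -/

/-- The algebraic symmetries of a curvature tensor. -/
structure IsCurvatureLike {V : Type*} [AddCommGroup V] [Module ℝ V] (R : V → V → V → V → ℝ) :
    Prop where
  add_left : ∀ u u' v w z, R (u + u') v w z = R u v w z + R u' v w z
  smul_left : ∀ (a : ℝ) u v w z, R (a • u) v w z = a * R u v w z
  swap_left : ∀ u v w z, R u v w z = -R v u w z
  swap_right : ∀ u v w z, R u v w z = -R u v z w
  bianchi : ∀ u v w z, R u v w z + R v w u z + R w u v z = 0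

namespace IsCurvatureLike

variable {V : Type*} [AddCommGroup V] [Module ℝ V] {R Q : V → V → V → V → ℝ}

/-- The classical combination of four Bianchi identities, one for each choice of the argument held
fixed in the last slot. -/
theorem pair_symm (h : IsCurvatureLike R) (u v w z : V) : R u v w z = R w z u v := by
  linarith [h.bianchi u v w z, h.bianchi v w z u, h.bianchi w z u v, h.bianchi z u v w,
    h.swap_right v w z u, h.swap_right z u w v, h.swap_right w u z v, h.swap_left u w z v,
    h.swap_right u w z v, h.swap_right u w v z, h.swap_right v z u w, h.swap_left v z u w,
    h.swap_right z v u w, h.swap_right v z w u, h.swap_right w z v u, h.swap_right u v z w,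
    h.swap_left w u v z, h.swap_left z v w u, h.swap_right z u v w, h.swap_right v w u z]

/-- Serves to subtract c times the tensor of constant curvature 1 and then show that the difference
vanishes. -/
theorem sub_smul (hR : IsCurvatureLike R) (hQ : IsCurvatureLike Q) (c : ℝ) :
    IsCurvatureLike fun u v w z ↦ R u v w z - c * Q u v w z where
  add_left u u' v w z := by rw [hR.add_left, hQ.add_left]; ring
  smul_left a u v w z := by rw [hR.smul_left, hQ.smul_left]; ring
  swap_left u v w z := by rw [hR.swap_left, hQ.swap_left]; ring
  swap_right u v w z := by rw [hR.swap_right, hQ.swap_right]; ring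
  bianchi u v w z := by linear_combination hR.bianchi u v w z - c * hQ.bianchi u v w z

theorem add_mid (h : IsCurvatureLike R) (u v v' w z : V) :
    R u (v + v') w z = R u v w z + R u v' w z := by
  rw [h.swap_left, h.add_left, h.swap_left u v, h.swap_left u v']; ring

theorem smul_mid (h : IsCurvatureLike R) (a : ℝ) (u v w z : V) :
    R u (a • v) w z = a * R u v w z := by
  rw [h.swap_left, h.smul_left, h.swap_left u v]; ring

theorem add_third (h : IsCurvatureLike R) (u v w w' z : V) :
    R u v (w + w') z = R u v w z + R u v w' z := by
  rw [h.pair_symm, h.add_left, h.pair_symm w, h.pair_symm w']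

theorem add_right (h : IsCurvatureLike R) (u v w z z' : V) :
    R u v w (z + z') = R u v w z + R u v w z' := by
  rw [h.pair_symm, h.add_mid, h.pair_symm w, h.pair_symm w]

theorem self_left (h : IsCurvatureLike R) (u w z : V) : R u u w z = 0 := by
  linarith [h.swap_left u u w z]

/-- A curvature-like tensor is determined by its sectional curvatures. -/
theorem eq_zero_of_sectional (h : IsCurvatureLike R) (L : Submodule ℝ V)
    (h0 : ∀ u ∈ L, ∀ v ∈ L, R u v v u = 0) {u v w z : V} (hu : u ∈ L) (hv : v ∈ L) (hw : w ∈ L)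
    (hz : z ∈ L) : R u v w z = 0 := by
  -- Polarisation in the two middle slots.
  have h1 : ∀ u ∈ L, ∀ v ∈ L, ∀ w ∈ L, R u v w u = 0 := by
    intro u hu v hv w hw
    have a := h0 u hu _ (L.add_mem hv hw)
    rw [h.add_mid, h.add_third, h.add_third, h0 u hu v hv, h0 u hu w hw] at a
    linarith [h.pair_symm u w v u, h.swap_left v u u w, h.swap_right u v u w]
  -- Polarisation in the two outer slots. With `swap_left`, R is then alternating in its first three
  -- slots, so the Bianchi identity reads 3R = 0.
  have h2 : ∀ u ∈ L, ∀ v ∈ L, ∀ w ∈ L, ∀ z ∈ L, R u v w z = -R u w v z := by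
    intro u hu v hv w hw z hz
    have a := h1 _ (L.add_mem hu hz) v hv w hw
    rw [h.add_left, h.add_right, h.add_right, h1 u hu v hv w hw, h1 z hz v hv w hw] at a
    linarith [h.pair_symm z v w u, h.swap_left w u z v, h.swap_right u w z v]
  linarith [h.bianchi u v w z, h2 u hu v hv w hw z hz, h2 v hv w hw u hu z hz,
    h.swap_left w u v z, h.swap_left v u w z]

end IsCurvatureLike

/-! ### The curvature tensor at a point. -/

section PointwiseCurvature

variable {x : M}

/-- The curvature tensor of type `(0, 4)`. -/
def curvatureForm (x : M) (u v w z : TangentSpace 𝓘(ℝ, E) x) : ℝ :=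
  g.inner x (curvature g x u v w) z

theorem curvatureForm_apply {X Y Z : Π x : M, TangentSpace 𝓘(ℝ, E) x}
    (hX : CMDiffAt ∞ (T% X) x) (hY : CMDiffAt ∞ (T% Y) x) (hZ : CMDiffAt ∞ (T% Z) x)
    (z : TangentSpace 𝓘(ℝ, E) x) :
    curvatureForm g x (X x) (Y x) (Z x) z = g.inner x (curvatureField g X Y Z x) z := by
  rw [curvatureForm, curvature_apply g hX hY hZ]

theorem isCurvatureLike_curvatureForm (x : M) : IsCurvatureLike (curvatureForm g x) where
  add_left u u' v w z := by
    have h1 := curvature_apply g ((smooth_extend u).add_section (smooth_extend u'))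
      (smooth_extend v) (smooth_extend w)
    simp only [Pi.add_apply, FiberBundle.extend_apply_self] at h1
    have h2 := curvatureField_add_left g (Y := FiberBundle.extend E v) (smooth_extend u)
      (smooth_extend u') (smooth_extend w)
    have h3 : curvature g x (u + u') v w = curvature g x u v w + curvature g x u' v w :=
      h1.trans h2
    simp only [curvatureForm, h3, map_add, add_apply]
  smul_left a u v w z := by
    have h1 := curvature_apply g ((contMDiffAt_const (c := a)).smul_section (smooth_extend u))
      (smooth_extend v) (smooth_extend w)
    simp only [Pi.smul_apply', FiberBundle.extend_apply_self] at h1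
    have h2 := curvatureField_smul_left g (Y := FiberBundle.extend E v)
      (contMDiffAt_const (c := a)) (smooth_extend u) (smooth_extend w)
    have h3 : curvature g x (a • u) v w = a • curvature g x u v w := h1.trans h2
    simp only [curvatureForm, h3, map_smul, smul_apply, smul_eq_mul]
  swap_left u v w z := by
    simp only [curvatureForm, curvature]
    rw [curvatureField_swap, map_neg, neg_apply]
  swap_right u v w z := by
    have := inner_curvatureField_swap g (smooth_extend u) (smooth_extend v) (smooth_extend w)
      (smooth_extend z)
    simp only [FiberBundle.extend_apply_self] at this
    exact this
  bianchi u v w z := by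
    have := curvatureField_bianchi g (smooth_extend u) (smooth_extend v) (smooth_extend w)
    simp only [curvatureForm, curvature]
    rw [← add_apply, ← add_apply, ← map_add, ← map_add, this, map_zero, zero_apply]

/-- The curvature tensor of constant sectional curvature `1`. -/
theorem isCurvatureLike_inner (x : M) :
    IsCurvatureLike fun u v w z : TangentSpace 𝓘(ℝ, E) x ↦
      g.inner x v w * g.inner x u z - g.inner x u w * g.inner x v z where
  add_left u u' v w z := by simp only [map_add, add_apply]; ring
  smul_left a u v w z := by simp only [map_smul, smul_apply, smul_eq_mul]; ring
  swap_left u v w z := by ring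
  swap_right u v w z := by ring
  bianchi u v w z := by
    rw [g.symm x w u, g.symm x w v, g.symm x v u]
    ring

end PointwiseCurvature

/-! ### Structure vector fields: invariance of η, f, Φ and g. -/

namespace MetricFStructure

variable {g} {s : ℕ} (S : MetricFStructure g s) {x : M}
  {X Y Z : Π x : M, TangentSpace 𝓘(ℝ, E) x}

/-- Metric compatibility with second argument ξ_α, where f ξ_α = 0. -/
theorem η_eq_inner (α : Fin s) (u : TangentSpace 𝓘(ℝ, E) x) :
    S.η α x u = g.inner x u (S.ξ α x) := by
  have h := S.inner_f_f x u (S.ξ α x)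
  rw [S.f_ξ, map_zero] at h
  simp only [S.η_ξ, mul_ite, mul_one, mul_zero, Finset.sum_ite_eq', Finset.mem_univ, if_true] at h
  linarith

/-- Metric compatibility with second argument `f v`, where f² is known and η ∘ f = 0. -/
theorem inner_f_left (u v : TangentSpace 𝓘(ℝ, E) x) :
    g.inner x (S.f x u) v = -g.inner x u (S.f x v) := by
  have h := S.inner_f_f x u (S.f x v)
  rw [S.f_f, map_add, map_neg, map_sum] at h
  simp only [map_smul, ← S.η_eq_inner, S.η_f, smul_zero, mul_zero, Finset.sum_const_zero] at h
  linarith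

theorem inner_ξ_ξ (α β : Fin s) :
    g.inner x (S.ξ α x) (S.ξ β x) = if α = β then 1 else 0 := by
  rw [← S.η_eq_inner, S.η_ξ]
  simp only [eq_comm]

theorem inner_f_ξ (α : Fin s) (u : TangentSpace 𝓘(ℝ, E) x) :
    g.inner x (S.f x u) (S.ξ α x) = 0 := by
  rw [← S.η_eq_inner, S.η_f]

theorem smooth_f_apply (hX : CMDiffAt ∞ (T% X) x) :
    CMDiffAt ∞ (T% (fun y ↦ S.f y (X y))) x :=
  ContMDiffAt.clm_bundle_apply (F₁ := E) (F₂ := E) S.smooth_f.contMDiffAt hX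

theorem mdiff_f_apply (hX : MDiffAt (T% X) x) : MDiffAt (T% (fun y ↦ S.f y (X y))) x :=
  MDifferentiableAt.clm_bundle_apply (F₁ := E) (F₂ := E)
    (S.smooth_f.contMDiffAt.mdifferentiableAt (by simp)) hX

theorem smoothAt_ξ (α : Fin s) : CMDiffAt ∞ (T% (S.ξ α)) x := (S.smooth_ξ α).contMDiffAt

theorem mdiff_ξ (α : Fin s) : MDiffAt (T% (S.ξ α)) x := smooth_mdiff (S.smoothAt_ξ α)

theorem η_apply_eq_metricFun (α : Fin s) :
    (fun y ↦ S.η α y (X y)) = metricFun g X (S.ξ α) :=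
  funext fun _ ↦ S.η_eq_inner α _

theorem mvfderiv_metricFun_ξ_ξ (α β : Fin s) :
    mvfderiv 𝓘(ℝ, E) (metricFun g (S.ξ α) (S.ξ β)) x = 0 := by
  have : metricFun g (S.ξ α) (S.ξ β) = fun _ ↦ if α = β then 1 else 0 :=
    funext fun _ ↦ S.inner_ξ_ξ α β
  rw [this, mvfderiv_const]

theorem mvfderiv_metricFun_f_ξ (α : Fin s) :
    mvfderiv 𝓘(ℝ, E) (metricFun g (fun y ↦ S.f y (X y)) (S.ξ α)) x = 0 := by
  have : metricFun g (fun y ↦ S.f y (X y)) (S.ξ α) = fun _ ↦ 0 :=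
    funext fun _ ↦ S.inner_f_ξ α _
  rw [this, mvfderiv_const]

namespace IsS

variable {S}

theorem two_fundamentalForm (hS : S.IsS) (α : Fin s) (hX : MDiffAt (T% X) x) (hY : MDiffAt (T% Y) x) :
    2 * g.inner x (X x) (S.f x (Y x))
      = mvfderiv 𝓘(ℝ, E) (metricFun g Y (S.ξ α)) x (X x)
        - mvfderiv 𝓘(ℝ, E) (metricFun g X (S.ξ α)) x (Y x)
        - g.inner x (mlieBracket 𝓘(ℝ, E) X Y x) (S.ξ α x) := by
  have h := hS.extDeriv_η α x X Y hX hY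
  rw [extDerivOneForm, S.η_apply_eq_metricFun, S.η_apply_eq_metricFun, S.η_eq_inner,
    fundamentalForm] at h
  linarith

/-- This is the invariance of η^β under ξ_α: dη^β(ξ_α, X) = Φ(ξ_α, X) = 0, and η^β(ξ_α) is constant.
-/
theorem mvfderiv_ξ (hS : S.IsS) (α β : Fin s) (hX : MDiffAt (T% X) x) :
    mvfderiv 𝓘(ℝ, E) (metricFun g X (S.ξ β)) x (S.ξ α x)
      = g.inner x (mlieBracket 𝓘(ℝ, E) (S.ξ α) X x) (S.ξ β x) := by
  have h := hS.two_fundamentalForm β (S.mdiff_ξ α) hX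
  rw [S.mvfderiv_metricFun_ξ_ξ, zero_apply, g.symm, S.inner_f_ξ] at h
  linarith

/-- The structure vector fields preserve `f`. -/
theorem f_mlieBracket_ξ (hS : S.IsS) (α : Fin s) (hX : MDiffAt (T% X) x) :
    mlieBracket 𝓘(ℝ, E) (S.ξ α) (fun y ↦ S.f y (X y)) x
      = S.f x (mlieBracket 𝓘(ℝ, E) (S.ξ α) X x) := by
  have h := hS.normal x (S.ξ α) X (S.mdiff_ξ α) hX
  have h0 : (fun y ↦ S.f y (S.ξ α y)) = 0 := funext fun y ↦ S.f_ξ y α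
  have h1 (β : Fin s) : extDerivOneForm (S.η β) (S.ξ α) X x = 0 := by
    rw [hS.extDeriv_η β x _ _ (S.mdiff_ξ α) hX, fundamentalForm, g.symm, S.inner_f_ξ]
  simp only [nijenhuis, h0, h1, mlieBracket_zero_left, Pi.zero_apply, map_zero, zero_smul,
    Finset.sum_const_zero, smul_zero, add_zero, sub_zero] at h
  -- Normality on (ξ_α, X) leaves f(f[ξ_α, X] - [ξ_α, fX]) = 0. A vector in the kernel of f vanishes
  -- once every η^β does on it, which `h3` checks.
  rw [← map_sub] at h
  have h2 := congrArg (S.f x) h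
  rw [S.f_f, map_zero] at h2
  have h3 (β : Fin s) : S.η β x (S.f x (mlieBracket 𝓘(ℝ, E) (S.ξ α) X x)
      - mlieBracket 𝓘(ℝ, E) (S.ξ α) (fun y ↦ S.f y (X y)) x) = 0 := by
    rw [map_sub, S.η_f, S.η_eq_inner, ← hS.mvfderiv_ξ α β (S.mdiff_f_apply hX),
      S.mvfderiv_metricFun_f_ξ, zero_apply, sub_zero]
  simp only [h3, zero_smul, Finset.sum_const_zero, add_zero, neg_eq_zero] at h2
  exact (sub_eq_zero.1 h2).symm

/-- The flow of ξ_α preserves η^α, hence dη^α = Φ. Written out: differentiate the formula for 2 dη^α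
along ξ_α, commute derivatives past each other at the cost of brackets, and use Jacobi. -/
theorem mvfderiv_ξ_fundamentalForm (hS : S.IsS) (α : Fin s) (hX : CMDiffAt ∞ (T% X) x)
    (hY : CMDiffAt ∞ (T% Y) x) :
    mvfderiv 𝓘(ℝ, E) (metricFun g X (fun y ↦ S.f y (Y y))) x (S.ξ α x)
      = g.inner x (mlieBracket 𝓘(ℝ, E) (S.ξ α) X x) (S.f x (Y x))
        + g.inner x (X x) (S.f x (mlieBracket 𝓘(ℝ, E) (S.ξ α) Y x)) := by
  have hξ := S.smoothAt_ξ (x := x) α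
  have sX := smooth_metricFun g hX hξ
  have sY := smooth_metricFun g hY hξ
  have dX := smooth_deriv g sX hY
  have dY := smooth_deriv g sY hX
  have bXY := smooth_bracket hX hY
  have sB := smooth_metricFun g bXY hξ
  have bX := smooth_bracket hξ hX
  have bY := smooth_bracket hξ hY
  have h1 : metricFun g X (fun y ↦ S.f y (Y y)) =ᶠ[𝓝 x] ((fun _ ↦ (1 / 2 : ℝ)) *
      ((fun y ↦ mvfderiv 𝓘(ℝ, E) (metricFun g Y (S.ξ α)) y (X y))
        - (fun y ↦ mvfderiv 𝓘(ℝ, E) (metricFun g X (S.ξ α)) y (Y y))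
        - metricFun g (mlieBracket 𝓘(ℝ, E) X Y) (S.ξ α))) := by
    filter_upwards [eventually_mdiff hX, eventually_mdiff hY] with y a b
    have := hS.two_fundamentalForm α a b
    simp only [metricFun, Pi.mul_apply, Pi.sub_apply]
    linarith
  have e1 {X : Π x : M, TangentSpace 𝓘(ℝ, E) x} (hX : CMDiffAt ∞ (T% X) x) :
      (fun y ↦ mvfderiv 𝓘(ℝ, E) (metricFun g X (S.ξ α)) y (S.ξ α y))
        =ᶠ[𝓝 x] metricFun g (mlieBracket 𝓘(ℝ, E) (S.ξ α) X) (S.ξ α) := by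
    filter_upwards [eventually_mdiff hX] with y a
    exact hS.mvfderiv_ξ α α a
  have c1 := mvfderiv_mlieBracket g hξ hX sY
  have c2 := mvfderiv_mlieBracket g hξ hY sX
  rw [mvfderiv_congr (e1 hY)] at c1
  rw [mvfderiv_congr (e1 hX)] at c2
  have le2 : minSmoothness ℝ 2 ≤ ∞ := by simpa using ENat.LEInfty.out
  have J := leibniz_identity_mlieBracket_apply (hξ.of_le le2) (hX.of_le le2) (hY.of_le le2)
  have f1 := hS.two_fundamentalForm α (smooth_mdiff bX) (smooth_mdiff hY)
  have f2 := hS.two_fundamentalForm α (smooth_mdiff hX) (smooth_mdiff bY)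
  have m1 := hS.mvfderiv_ξ α α (smooth_mdiff bXY)
  rw [J, map_add, add_apply] at m1
  have hc : mvfderiv 𝓘(ℝ, E) (fun _ : M ↦ (1 / 2 : ℝ)) x = 0 := mvfderiv_const ..
  rw [mvfderiv_congr h1, mvfderiv_mul mdifferentiableAt_const
    (((smooth_mdiff_fun dY).sub (smooth_mdiff_fun dX)).sub (smooth_mdiff_fun sB)),
    mvfderiv_sub ((smooth_mdiff_fun dY).sub (smooth_mdiff_fun dX)) (smooth_mdiff_fun sB),
    mvfderiv_sub (smooth_mdiff_fun dY) (smooth_mdiff_fun dX), hc]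
  simp only [smul_zero, add_zero, sub_apply, smul_apply, smul_eq_mul]
  linarith

/-- The structure vector fields are Killing fields. -/
theorem mvfderiv_ξ_metricFun (hS : S.IsS) (α : Fin s) (hX : CMDiffAt ∞ (T% X) x)
    (hY : CMDiffAt ∞ (T% Y) x) :
    mvfderiv 𝓘(ℝ, E) (metricFun g X Y) x (S.ξ α x)
      = g.inner x (mlieBracket 𝓘(ℝ, E) (S.ξ α) X x) (Y x)
        + g.inner x (X x) (mlieBracket 𝓘(ℝ, E) (S.ξ α) Y x) := by
  have hξ (β : Fin s) := S.smoothAt_ξ (x := x) β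
  have hf := S.smooth_f_apply hX
  -- g(X, Y) = Φ(fX, Y) + Σ η^β(X) η^β(Y), and every ingredient is invariant under ξ_α.
  have h1 : metricFun g X Y = metricFun g (fun y ↦ S.f y (X y)) (fun y ↦ S.f y (Y y))
      + fun y ↦ ∑ β, (metricFun g X (S.ξ β) * metricFun g Y (S.ξ β)) y := by
    funext y
    simp only [metricFun, Pi.add_apply, Pi.mul_apply, S.inner_f_f, S.η_eq_inner]
    ring
  have h2 (β : Fin s) : MDiffAt (metricFun g X (S.ξ β) * metricFun g Y (S.ξ β)) x :=
    (smooth_mdiff_fun (smooth_metricFun g hX (hξ β))).mul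
      (smooth_mdiff_fun (smooth_metricFun g hY (hξ β)))
  have h3 (t : Finset (Fin s)) :
      MDiffAt (fun y ↦ ∑ β ∈ t, (metricFun g X (S.ξ β) * metricFun g Y (S.ξ β)) y) x ∧
      mvfderiv 𝓘(ℝ, E) (fun y ↦ ∑ β ∈ t, (metricFun g X (S.ξ β) * metricFun g Y (S.ξ β)) y) x
        (S.ξ α x) = ∑ β ∈ t,
          (g.inner x (X x) (S.ξ β x) * g.inner x (mlieBracket 𝓘(ℝ, E) (S.ξ α) Y x) (S.ξ β x)
          + g.inner x (Y x) (S.ξ β x) * g.inner x (mlieBracket 𝓘(ℝ, E) (S.ξ α) X x) (S.ξ β x)) := by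
    classical
    induction t using Finset.induction_on with
    | empty =>
      simp only [Finset.sum_empty]
      refine ⟨mdifferentiableAt_const, ?_⟩
      rw [mvfderiv_const, zero_apply]
    | insert b t hb ih =>
      simp only [Finset.sum_insert hb]
      refine ⟨(h2 b).add ih.1, ?_⟩
      have := mvfderiv_add (h2 b) ih.1
      rw [← ih.2, ← hS.mvfderiv_ξ α b (smooth_mdiff hX), ← hS.mvfderiv_ξ α b (smooth_mdiff hY)]
      refine (congrArg (fun L ↦ L (S.ξ α x)) this).trans ?_
      rw [mvfderiv_mul (smooth_mdiff_fun (smooth_metricFun g hX (hξ b)))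
        (smooth_mdiff_fun (smooth_metricFun g hY (hξ b)))]
      rfl
  rw [h1, mvfderiv_add (smooth_mdiff_fun (smooth_metricFun g hf (S.smooth_f_apply hY)))
    (h3 _).1, add_apply, (h3 _).2, hS.mvfderiv_ξ_fundamentalForm α hf hY,
    hS.f_mlieBracket_ξ α (smooth_mdiff hX), S.inner_f_f, S.inner_f_f, Finset.sum_add_distrib]
  simp only [S.η_eq_inner, mul_comm]
  ring

/-- `∇_v ξ = - f v`. -/
theorem leviCivita_ξ (hS : S.IsS) (α : Fin s) (v : TangentSpace 𝓘(ℝ, E) x) :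
    leviCivita g (S.ξ α) x v = -S.f x v := by
  apply inner_injective g x
  ext w
  set V : Π y : M, TangentSpace 𝓘(ℝ, E) y := FiberBundle.extend E v with hVdef
  set W : Π y : M, TangentSpace 𝓘(ℝ, E) y := FiberBundle.extend E w with hWdef
  have hV : CMDiffAt ∞ (T% V) x := smooth_extend v
  have hW : CMDiffAt ∞ (T% W) x := smooth_extend w
  have hVx : V x = v := FiberBundle.extend_apply_self ..
  have hWx : W x = w := FiberBundle.extend_apply_self ..
  have dV := smooth_mdiff hV
  have dW := smooth_mdiff hW
  have hξ := S.mdiff_ξ (x := x) α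
  -- `h1` gives the skew part of ∇ξ_α, while the Killing equation `h2` says that its symmetric part
  -- is zero.
  have h1 := hS.two_fundamentalForm α dV dW
  have h2 := hS.mvfderiv_ξ_metricFun α hV hW
  rw [leviCivita_metric g dV dW hξ, leviCivita_metric g dW dV hξ,
    mlieBracket_eq_leviCivita g dV dW] at h1
  rw [leviCivita_metric g hξ dV dW, mlieBracket_eq_leviCivita g hξ dV,
    mlieBracket_eq_leviCivita g hξ dW] at h2
  simp only [map_sub, sub_apply, hVx, hWx] at h1 h2
  rw [map_neg, neg_apply, S.inner_f_left, g.symm]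
  linarith [g.symm x v (leviCivita g (S.ξ α) x w), g.symm x w (leviCivita g (S.ξ α) x v)]

end IsS
end MetricFStructure

/-! ### The covariant derivative of f. -/

namespace MetricFStructure

variable {g} {s : ℕ} (S : MetricFStructure g s) {x : M}
  {X Y Z : Π x : M, TangentSpace 𝓘(ℝ, E) x}

theorem tensorialAt_covDeriv_f (v : TangentSpace 𝓘(ℝ, E) x) :
    TensorialAt 𝓘(ℝ, E) E (fun Y : Π x : M, TangentSpace 𝓘(ℝ, E) x ↦
      leviCivita g (fun y ↦ S.f y (Y y)) x v - S.f x (leviCivita g Y x v)) x where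
  smul {φ Y} hφ hY := by
    have h1 : (fun y ↦ S.f y ((φ • Y) y)) = φ • fun y ↦ S.f y (Y y) := by
      funext y
      simp
    rw [h1, leviCivita_smul g hφ (S.mdiff_f_apply hY), leviCivita_smul g hφ hY]
    simp only [map_add, map_smul]
    module
  add {Y Z} hY hZ := by
    have h1 : (fun y ↦ S.f y ((Y + Z) y)) = (fun y ↦ S.f y (Y y)) + fun y ↦ S.f y (Z y) := by
      funext y
      simp
    rw [h1, leviCivita_add g (S.mdiff_f_apply hY) (S.mdiff_f_apply hZ), leviCivita_add g hY hZ]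
    simp only [map_add]
    abel

/-- The covariant derivative `(∇_v f) w` of the structure tensor. -/
def covDerivF (x : M) (v : TangentSpace 𝓘(ℝ, E) x) :
    TangentSpace 𝓘(ℝ, E) x →L[ℝ] TangentSpace 𝓘(ℝ, E) x :=
  TensorialAt.mkHom _ x (S.tensorialAt_covDeriv_f v)

theorem leviCivita_f_apply (hY : MDiffAt (T% Y) x) (v : TangentSpace 𝓘(ℝ, E) x) :
    leviCivita g (fun y ↦ S.f y (Y y)) x v
      = S.f x (leviCivita g Y x v) + S.covDerivF x v (Y x) := by
  have := TensorialAt.mkHom_apply (S.tensorialAt_covDeriv_f v) hY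
  rw [covDerivF, this]
  abel

theorem inner_sum_ξ (z : TangentSpace 𝓘(ℝ, E) x) :
    g.inner x (∑ α, S.ξ α x) z = ∑ α, S.η α x z := by
  rw [g.symm, map_sum]
  exact Finset.sum_congr rfl fun α _ ↦ (S.η_eq_inner α z).symm

theorem inner_covDerivF_swap (u v w : TangentSpace 𝓘(ℝ, E) x) :
    g.inner x (S.covDerivF x u v) w = -g.inner x (S.covDerivF x u w) v := by
  set U : Π y : M, TangentSpace 𝓘(ℝ, E) y := FiberBundle.extend E u with hU
  set V : Π y : M, TangentSpace 𝓘(ℝ, E) y := FiberBundle.extend E v with hV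
  set W : Π y : M, TangentSpace 𝓘(ℝ, E) y := FiberBundle.extend E w with hW
  have dU : MDiffAt (T% U) x := smooth_mdiff (smooth_extend u)
  have dV : MDiffAt (T% V) x := smooth_mdiff (smooth_extend v)
  have dW : MDiffAt (T% W) x := smooth_mdiff (smooth_extend w)
  have hUx : U x = u := FiberBundle.extend_apply_self ..
  have hVx : V x = v := FiberBundle.extend_apply_self ..
  have hWx : W x = w := FiberBundle.extend_apply_self ..
  have h1 := leviCivita_metric g dU (S.mdiff_f_apply dV) dW
  have h2 := leviCivita_metric g dU dV (S.mdiff_f_apply dW)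
  have h3 : metricFun g (fun y ↦ S.f y (V y)) W = -metricFun g V (fun y ↦ S.f y (W y)) := by
    funext y
    simp only [metricFun, Pi.neg_apply, S.inner_f_left]
  rw [h3, mvfderiv_neg, neg_apply, h2, S.leviCivita_f_apply dV, S.leviCivita_f_apply dW] at h1
  simp only [map_add, add_apply, S.inner_f_left, hUx, hVx, hWx] at h1
  linarith [g.symm x v (S.covDerivF x u w)]

namespace IsS

variable {S}

/-- Differentiate f ξ_α = 0 and use ∇ξ_α = -f. -/
theorem covDerivF_ξ (hS : S.IsS) (α : Fin s) (v : TangentSpace 𝓘(ℝ, E) x) :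
    S.covDerivF x v (S.ξ α x) = S.f x (S.f x v) := by
  have h := S.leviCivita_f_apply (S.mdiff_ξ (x := x) α) v
  have h0 : (fun y ↦ S.f y (S.ξ α y)) = 0 := funext fun y ↦ S.f_ξ y α
  rw [h0, leviCivita_zero, hS.leviCivita_ξ, map_neg] at h
  exact (neg_add_eq_zero.1 h.symm).symm

/-- With ∇ξ_α = -f, the second derivatives of ξ_α are first derivatives of f; the terms f(∇_X Y)
cancel by zero torsion. -/
theorem curvatureField_ξ (hS : S.IsS) (α : Fin s) (hX : CMDiffAt ∞ (T% X) x) (hY : CMDiffAt ∞ (T% Y) x) :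
    curvatureField g X Y (S.ξ α) x = S.covDerivF x (Y x) (X x) - S.covDerivF x (X x) (Y x) := by
  have key {X Y : Π x : M, TangentSpace 𝓘(ℝ, E) x} (hY : MDiffAt (T% Y) x) :
      leviCivita g (fun y ↦ leviCivita g (S.ξ α) y (Y y)) x (X x)
        = -(S.f x (leviCivita g Y x (X x)) + S.covDerivF x (X x) (Y x)) := by
    have : (fun y ↦ leviCivita g (S.ξ α) y (Y y)) = -fun y ↦ S.f y (Y y) :=
      funext fun y ↦ hS.leviCivita_ξ α _
    rw [this, leviCivita_neg g (S.mdiff_f_apply hY), S.leviCivita_f_apply hY]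
  rw [curvatureField, key (smooth_mdiff hX), key (smooth_mdiff hY), hS.leviCivita_ξ,
    mlieBracket_eq_leviCivita g (smooth_mdiff hX) (smooth_mdiff hY), map_sub]
  abel

theorem curvatureForm_ξ (hS : S.IsS) (α : Fin s) (u v z : TangentSpace 𝓘(ℝ, E) x) :
    curvatureForm g x u v (S.ξ α x) z
      = g.inner x (S.covDerivF x v u) z - g.inner x (S.covDerivF x u v) z := by
  have h1 := curvatureForm_apply g (smooth_extend u) (smooth_extend v) (S.smoothAt_ξ α) z
  have h2 := hS.curvatureField_ξ α (smooth_extend u) (smooth_extend v)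
  rw [h2] at h1
  simp only [FiberBundle.extend_apply_self, map_sub, sub_apply] at h1
  exact h1

/-- The fundamental form is closed. -/
theorem covDerivF_cyclic (hS : S.IsS) (hs : 1 ≤ s) (u v w : TangentSpace 𝓘(ℝ, E) x) :
    g.inner x (S.covDerivF x u v) w + g.inner x (S.covDerivF x v w) u
      + g.inner x (S.covDerivF x w u) v = 0 := by
  have hR := isCurvatureLike_curvatureForm g x
  -- Closedness comes from the Bianchi identity for R(u, v, w, ξ_α) rather than from d² = 0; any
  -- single ξ_α suffices.
  let α : Fin s := ⟨0, hs⟩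
  linarith [hR.bianchi u v w (S.ξ α x), hR.swap_right u v w (S.ξ α x),
    hR.swap_right v w u (S.ξ α x), hR.swap_right w u v (S.ξ α x), hS.curvatureForm_ξ α u v w,
    hS.curvatureForm_ξ α v w u, hS.curvatureForm_ξ α w u v, S.inner_covDerivF_swap u v w,
    S.inner_covDerivF_swap v w u, S.inner_covDerivF_swap w u v]

theorem leviCivita_ff_apply (hS : S.IsS) (hY : MDiffAt (T% Y) x) (v : TangentSpace 𝓘(ℝ, E) x) :
    leviCivita g (fun y ↦ S.f y (S.f y (Y y))) x v
      = S.f x (S.f x (leviCivita g Y x v))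
        - ∑ α, (g.inner x (S.f x v) (Y x) • S.ξ α x + S.η α x (Y x) • S.f x v) := by
  have hm (α : Fin s) : MDiffAt (metricFun g Y (S.ξ α)) x := metricFun_mdiff g hY (S.mdiff_ξ α)
  have h1 : (fun y ↦ S.f y (S.f y (Y y)))
      = -Y + fun y ↦ ∑ α, (metricFun g Y (S.ξ α) • S.ξ α) y := by
    funext y
    rw [S.f_f]
    simp only [Pi.add_apply, Pi.neg_apply, Pi.smul_apply', S.η_eq_inner, metricFun]
  have h2 (α : Fin s) : mvfderiv 𝓘(ℝ, E) (metricFun g Y (S.ξ α)) x v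
      = S.η α x (leviCivita g Y x v) - g.inner x (S.f x v) (Y x) := by
    have := leviCivita_metric g (x := x) (smooth_mdiff (smooth_extend v)) hY (S.mdiff_ξ α)
    simp only [FiberBundle.extend_apply_self] at this
    rw [this, hS.leviCivita_ξ, S.η_eq_inner, map_neg, g.symm x (S.f x v)]
    ring
  rw [h1, leviCivita_add g (mdifferentiableAt_neg_section hY)
    (.sum_section fun α _ ↦ (hm α).smul_section (S.mdiff_ξ α)), leviCivita_neg g hY,
    leviCivita_sum g _ fun α ↦ (hm α).smul_section (S.mdiff_ξ α), S.f_f, add_sub_assoc,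
    ← Finset.sum_sub_distrib]
  congr 1
  refine Finset.sum_congr rfl fun α _ ↦ ?_
  rw [leviCivita_smul g (hm α) (S.mdiff_ξ α), h2, hS.leviCivita_ξ, metricFun, ← S.η_eq_inner]
  module

/-- The derivative of f² computed by the product rule and from f² = -I + Σ η^α ⊗ ξ_α. -/
theorem covDerivF_f (hS : S.IsS) (v w : TangentSpace 𝓘(ℝ, E) x) :
    S.covDerivF x v (S.f x w) + S.f x (S.covDerivF x v w)
      = -∑ α, (g.inner x (S.f x v) w • S.ξ α x + S.η α x w • S.f x v) := by
  have hW := smooth_mdiff (smooth_extend (x := x) w)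
  have h1 := hS.leviCivita_ff_apply hW v
  rw [S.leviCivita_f_apply (S.mdiff_f_apply hW), S.leviCivita_f_apply hW, map_add] at h1
  simp only [FiberBundle.extend_apply_self] at h1
  rw [sub_eq_add_neg, add_assoc, add_right_inj] at h1
  rw [← h1, add_comm]

/-- Normality with all brackets written through ∇: only the terms containing ∇f survive. -/
theorem covDerivF_nijenhuis (hS : S.IsS) (u v : TangentSpace 𝓘(ℝ, E) x) :
    S.covDerivF x (S.f x u) v - S.covDerivF x (S.f x v) u + S.f x (S.covDerivF x v u)
      - S.f x (S.covDerivF x u v) = -((2 * g.inner x u (S.f x v)) • ∑ α, S.ξ α x) := by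
  set U : Π y : M, TangentSpace 𝓘(ℝ, E) y := FiberBundle.extend E u with hU
  set V : Π y : M, TangentSpace 𝓘(ℝ, E) y := FiberBundle.extend E v with hV
  have dU : MDiffAt (T% U) x := smooth_mdiff (smooth_extend u)
  have dV : MDiffAt (T% V) x := smooth_mdiff (smooth_extend v)
  have hUx : U x = u := FiberBundle.extend_apply_self ..
  have hVx : V x = v := FiberBundle.extend_apply_self ..
  have h := hS.normal x U V dU dV
  simp only [hS.extDeriv_η _ x U V dU dV, fundamentalForm, ← Finset.smul_sum, smul_smul] at h
  rw [nijenhuis, mlieBracket_eq_leviCivita g dU dV,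
    mlieBracket_eq_leviCivita g (S.mdiff_f_apply dU) (S.mdiff_f_apply dV),
    mlieBracket_eq_leviCivita g (S.mdiff_f_apply dU) dV,
    mlieBracket_eq_leviCivita g dU (S.mdiff_f_apply dV), S.leviCivita_f_apply dU,
    S.leviCivita_f_apply dV, S.leviCivita_f_apply dU, S.leviCivita_f_apply dV] at h
  simp only [map_sub, map_add, hUx, hVx] at h
  rw [← sub_eq_zero, sub_neg_eq_add, ← h]
  abel

/-- As for Kähler manifolds, closedness and integrability pin down ∇f. Put T(a, b, c) = g((∇_a f) b,
c). Subtracting the cyclic identities for (fv, w, u) and (fw, v, u) and eliminating with normality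
(`hN`) and the derivative of f² (`hf`) isolates 2 T(u, fv, w). -/
theorem inner_covDerivF_f (hS : S.IsS) (hs : 1 ≤ s) (u v w : TangentSpace 𝓘(ℝ, E) x) :
    g.inner x (S.covDerivF x u (S.f x v)) w
      = g.inner x u (S.f x v) * ∑ α, S.η α x w := by
  have hf (u v z : TangentSpace 𝓘(ℝ, E) x) :
      g.inner x (S.covDerivF x u (S.f x v)) z - g.inner x (S.covDerivF x u v) (S.f x z)
        = -(g.inner x (S.f x u) v * ∑ α, S.η α x z)
          - (∑ α, S.η α x v) * g.inner x (S.f x u) z := by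
    have h := congrArg (fun a ↦ g.inner x a z) (hS.covDerivF_f u v)
    simp only [map_add, add_apply, map_neg, neg_apply, Finset.sum_add_distrib, ← Finset.smul_sum,
      ← Finset.sum_smul, map_smul, smul_apply, smul_eq_mul, S.inner_f_left _ z, S.inner_sum_ξ] at h
    linear_combination h + (∑ α, S.η α x v) * S.inner_f_left u z
  have hN (u v z : TangentSpace 𝓘(ℝ, E) x) :
      g.inner x (S.covDerivF x (S.f x u) v) z - g.inner x (S.covDerivF x (S.f x v) u) z
        - g.inner x (S.covDerivF x v u) (S.f x z) + g.inner x (S.covDerivF x u v) (S.f x z)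
        = -2 * (g.inner x u (S.f x v) * ∑ α, S.η α x z) := by
    have h := congrArg (fun a ↦ g.inner x a z) (hS.covDerivF_nijenhuis u v)
    simp only [map_add, add_apply, map_neg, neg_apply, map_sub, sub_apply, map_smul, smul_apply,
      smul_eq_mul, S.inner_f_left _ z, S.inner_sum_ξ] at h
    linarith
  have hm (u v z : TangentSpace 𝓘(ℝ, E) x) : g.inner x u (S.f x v) * ∑ α, S.η α x z
      = -(g.inner x v (S.f x u) * ∑ α, S.η α x z) := by
    rw [← neg_mul, ← S.inner_f_left, g.symm]
  have hm' (u v z : TangentSpace 𝓘(ℝ, E) x) : g.inner x (S.f x u) v * ∑ α, S.η α x z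
      = -(g.inner x u (S.f x v) * ∑ α, S.η α x z) := by
    rw [← neg_mul, ← S.inner_f_left]
  have a1 := hS.covDerivF_cyclic hs (S.f x v) w u
  have a2 := hS.covDerivF_cyclic hs (S.f x w) v u
  have b1 := hf v w u
  have b2 := hf w v u
  have b3 := hf u v w
  rw [mul_comm (∑ α, S.η α x _)] at b1 b2 b3
  linarith [hN v w u, S.inner_covDerivF_swap w u (S.f x v), S.inner_covDerivF_swap v u (S.f x w),
    S.inner_covDerivF_swap u v (S.f x w), S.inner_covDerivF_swap u w (S.f x v), hm v w u, hm v u w,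
    hm w u v, hm' v w u, hm' w v u, hm' v u w, hm' w u v, hm' u v w, hm' u w v]

/-- The covariant derivative of the structure tensor of an `S`-manifold. -/
theorem covDerivF_eq (hS : S.IsS) (hs : 1 ≤ s) (v w : TangentSpace 𝓘(ℝ, E) x) :
    S.covDerivF x v w = g.inner x (S.f x v) (S.f x w) • ∑ α, S.ξ α x
      + (∑ α, S.η α x w) • S.f x (S.f x v) := by
  have h1 (w : TangentSpace 𝓘(ℝ, E) x) :
      S.covDerivF x v (S.f x w) = g.inner x v (S.f x w) • ∑ α, S.ξ α x := by
    apply inner_injective g x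
    ext z
    rw [hS.inner_covDerivF_f hs, map_smul, smul_apply, S.inner_sum_ξ, smul_eq_mul]
  -- `h1` covers the image of f; since f² w = -w + Σ η^α(w) ξ_α, what is missing is ∇f on ξ_α, given
  -- by `covDerivF_ξ`.
  have h2 := h1 (S.f x w)
  rw [S.f_f, map_add, map_neg, map_sum] at h2
  simp only [map_smul, hS.covDerivF_ξ, ← Finset.sum_smul] at h2
  have h3 : g.inner x v (-w + ∑ α, S.η α x w • S.ξ α x) = -g.inner x (S.f x v) (S.f x w) := by
    rw [← S.f_f, S.inner_f_left, neg_neg]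
  rw [h3] at h2
  rw [← sub_eq_zero, ← neg_eq_zero, ← sub_eq_zero.2 h2]
  module

end IsS
end MetricFStructure

/-! ### Curvature of an S-manifold: ξ-directions and commutator with f. -/

namespace MetricFStructure

variable {g} {s : ℕ} (S : MetricFStructure g s) {x : M}
  {X Y Z : Π x : M, TangentSpace 𝓘(ℝ, E) x}

theorem inner_f_f_apply (u z : TangentSpace 𝓘(ℝ, E) x) :
    g.inner x (S.f x (S.f x u)) z = -g.inner x (S.f x u) (S.f x z) :=
  S.inner_f_left _ _

theorem inner_f_f_of_η_eq_zero {z : TangentSpace 𝓘(ℝ, E) x} (hz : ∀ α, S.η α x z = 0)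
    (u : TangentSpace 𝓘(ℝ, E) x) : g.inner x (S.f x u) (S.f x z) = g.inner x u z := by
  simp [S.inner_f_f, hz]

theorem smooth_sum_ξ : CMDiffAt ∞ (T% (fun y ↦ ∑ α, S.ξ α y)) x :=
  .sum_section fun α _ ↦ S.smoothAt_ξ α

namespace IsS

variable {S}

theorem leviCivita_sum_ξ (hS : S.IsS) (v : TangentSpace 𝓘(ℝ, E) x) :
    leviCivita g (fun y ↦ ∑ α, S.ξ α y) x v = -((s : ℝ) • S.f x v) := by
  rw [leviCivita_sum g _ fun α ↦ S.mdiff_ξ α]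
  simp only [hS.leviCivita_ξ, Finset.sum_neg_distrib, Finset.sum_const, Finset.card_univ,
    Fintype.card_fin, Nat.cast_smul_eq_nsmul]

/-- In the antisymmetrised ∇f the part along Σ ξ_β is symmetric and cancels. -/
theorem curvatureForm_ξ_eq (hS : S.IsS) (hs : 1 ≤ s) (α : Fin s) (u v z : TangentSpace 𝓘(ℝ, E) x) :
    curvatureForm g x u v (S.ξ α x) z
      = (∑ β, S.η β x v) * g.inner x (S.f x u) (S.f x z)
        - (∑ β, S.η β x u) * g.inner x (S.f x v) (S.f x z) := by
  rw [hS.curvatureForm_ξ, hS.covDerivF_eq hs, hS.covDerivF_eq hs]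
  simp only [map_add, add_apply, map_smul, smul_apply, smul_eq_mul, S.inner_f_f_apply]
  rw [g.symm x (S.f x v) (S.f x u)]
  ring

/-- Differentiate ∇_Y(fZ) = f ∇_Y Z + g(fY, fZ) ξ + η(Z) f² Y once more, with ξ and η the sums over
α, and keep the 𝓛-component. As Z lies in 𝓛 at `x` only, η(Z) vanishes there but its derivative does
not. The factors s come from ∇ξ = -s f. -/
theorem inner_leviCivita_leviCivita_f (hS : S.IsS) (hs : 1 ≤ s) (hX : CMDiffAt ∞ (T% X) x)
    (hY : CMDiffAt ∞ (T% Y) x) (hZ : CMDiffAt ∞ (T% Z) x) (hZ0 : ∀ α, S.η α x (Z x) = 0)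
    {w : TangentSpace 𝓘(ℝ, E) x} (hw : ∀ α, S.η α x w = 0) :
    g.inner x (leviCivita g (fun y ↦ leviCivita g (fun z ↦ S.f z (Z z)) y (Y y)) x (X x)) w
      = g.inner x (S.f x (leviCivita g (fun y ↦ leviCivita g Z y (Y y)) x (X x))) w
        - (∑ α, S.η α x (leviCivita g Z x (Y x))) * g.inner x (X x) w
        - s * g.inner x (Y x) (Z x) * g.inner x (S.f x (X x)) w
        - ((∑ α, S.η α x (leviCivita g Z x (X x))) - s * g.inner x (S.f x (X x)) (Z x))
          * g.inner x (Y x) w := by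
  have hξ := S.smooth_sum_ξ (x := x)
  have hfY := S.smooth_f_apply hY
  have hfZ := S.smooth_f_apply hZ
  have hffY := S.smooth_f_apply hfY
  have hφ := smooth_metricFun g hfY hfZ
  have hψ := smooth_metricFun g hZ hξ
  have hYZ := smooth_leviCivita g hY hZ
  have h1 : (fun y ↦ leviCivita g (fun z ↦ S.f z (Z z)) y (Y y)) =ᶠ[𝓝 x]
      ((fun y ↦ S.f y (leviCivita g Z y (Y y)))
        + metricFun g (fun y ↦ S.f y (Y y)) (fun y ↦ S.f y (Z y)) • (fun y ↦ ∑ α, S.ξ α y)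
        + metricFun g Z (fun y ↦ ∑ α, S.ξ α y) • fun y ↦ S.f y (S.f y (Y y))) := by
    filter_upwards [eventually_mdiff hZ] with y a
    rw [S.leviCivita_f_apply a, hS.covDerivF_eq hs, ← add_assoc, ← S.inner_sum_ξ,
      g.symm y (∑ α, S.ξ α y)]
    rfl
  have hψX : mvfderiv 𝓘(ℝ, E) (metricFun g Z (fun y ↦ ∑ α, S.ξ α y)) x (X x)
      = (∑ α, S.η α x (leviCivita g Z x (X x))) - s * g.inner x (S.f x (X x)) (Z x) := by
    rw [leviCivita_metric g (smooth_mdiff hX) (smooth_mdiff hZ) (smooth_mdiff hξ),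
      hS.leviCivita_sum_ξ, g.symm, S.inner_sum_ξ, map_neg, map_smul, g.symm x (S.f x (X x)),
      smul_eq_mul]
    ring
  have hψx : metricFun g Z (fun y ↦ ∑ α, S.ξ α y) x = 0 := by
    rw [metricFun, g.symm, S.inner_sum_ξ]
    exact Finset.sum_eq_zero fun α _ ↦ hZ0 α
  have hφx : metricFun g (fun y ↦ S.f y (Y y)) (fun y ↦ S.f y (Z y)) x
      = g.inner x (Y x) (Z x) := S.inner_f_f_of_η_eq_zero hZ0 _
  have hσw : ∑ α, S.η α x w = 0 := Finset.sum_eq_zero fun α _ ↦ hw α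
  have m1 := smooth_mdiff (S.smooth_f_apply hYZ)
  have m2 := (smooth_mdiff_fun hφ).smul_section (smooth_mdiff hξ)
  have m3 := (smooth_mdiff_fun hψ).smul_section (smooth_mdiff hffY)
  rw [leviCivita_congr g (smooth_mdiff (smooth_leviCivita g hY hfZ)) h1,
    leviCivita_add g (mdifferentiableAt_add_section m1 m2) m3, leviCivita_add g m1 m2,
    S.leviCivita_f_apply (smooth_mdiff hYZ), hS.covDerivF_eq hs,
    leviCivita_smul g (smooth_mdiff_fun hφ) (smooth_mdiff hξ),
    leviCivita_smul g (smooth_mdiff_fun hψ) (smooth_mdiff hffY), hS.leviCivita_sum_ξ, hψX, hψx,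
    hφx]
  simp only [map_add, add_apply, map_smul, smul_apply, smul_eq_mul, map_neg, neg_apply,
    S.inner_sum_ξ, hσw, S.inner_f_f_apply, S.inner_f_f_of_η_eq_zero hw]
  ring

/-- The commutator of the curvature and the structure tensor. -/
theorem curvatureForm_f (hS : S.IsS) (hs : 1 ≤ s) (u v : TangentSpace 𝓘(ℝ, E) x)
    {w z : TangentSpace 𝓘(ℝ, E) x} (hw : ∀ α, S.η α x w = 0) (hz : ∀ α, S.η α x z = 0) :
    curvatureForm g x u v (S.f x w) z + curvatureForm g x u v w (S.f x z)
      = s * (g.inner x (S.f x u) w * g.inner x v z - g.inner x (S.f x v) w * g.inner x u z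
        - g.inner x v w * g.inner x (S.f x u) z + g.inner x u w * g.inner x (S.f x v) z) := by
  set U : Π y : M, TangentSpace 𝓘(ℝ, E) y := FiberBundle.extend E u with hU
  set V : Π y : M, TangentSpace 𝓘(ℝ, E) y := FiberBundle.extend E v with hV
  set W : Π y : M, TangentSpace 𝓘(ℝ, E) y := FiberBundle.extend E w with hW
  have sU : CMDiffAt ∞ (T% U) x := smooth_extend u
  have sV : CMDiffAt ∞ (T% V) x := smooth_extend v
  have sW : CMDiffAt ∞ (T% W) x := smooth_extend w
  have hUx : U x = u := FiberBundle.extend_apply_self ..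
  have hVx : V x = v := FiberBundle.extend_apply_self ..
  have hWx : W x = w := FiberBundle.extend_apply_self ..
  have hW0 (α) : S.η α x (W x) = 0 := by rw [hWx, hw]
  have h1 := curvatureForm_apply g sU sV (S.smooth_f_apply sW) z
  have h2 := curvatureForm_apply g sU sV sW (S.f x z)
  -- The terms with Σ η^α(∇Z) are symmetric in the two directions, so they cancel in `k1` minus
  -- `k2`; only the s-terms remain.
  have k1 := hS.inner_leviCivita_leviCivita_f hs sU sV sW hW0 hz
  have k2 := hS.inner_leviCivita_leviCivita_f hs sV sU sW hW0 hz
  have k3 : g.inner x (leviCivita g (fun z ↦ S.f z (W z)) x (mlieBracket 𝓘(ℝ, E) U V x)) z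
      = g.inner x (S.f x (leviCivita g W x (mlieBracket 𝓘(ℝ, E) U V x))) z := by
    have hσw : ∑ α, S.η α x w = 0 := Finset.sum_eq_zero fun α _ ↦ hw α
    have hσz : ∑ α, S.η α x z = 0 := Finset.sum_eq_zero fun α _ ↦ hz α
    rw [S.leviCivita_f_apply (smooth_mdiff sW), hS.covDerivF_eq hs, hWx, hσw, zero_smul, add_zero,
      map_add, add_apply, map_smul, smul_apply, S.inner_sum_ξ, hσz, smul_zero, add_zero]
  simp only [curvatureField, map_sub, sub_apply, hUx, hVx, hWx, k3] at h1 h2 k1 k2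
  rw [h1, h2]
  simp only [S.inner_f_left] at k1 k2 ⊢
  linarith

end IsS
end MetricFStructure

theorem IsCurvatureLike.sum_smul_third {V : Type*} [AddCommGroup V] [Module ℝ V]
    {R : V → V → V → V → ℝ} (h : IsCurvatureLike R) {ι : Type*} (t : Finset ι) (u v z : V)
    (a : ι → ℝ) (w : ι → V) : R u v (∑ i ∈ t, a i • w i) z = ∑ i ∈ t, a i * R u v (w i) z := by
  let L : V →ₗ[ℝ] ℝ :=
    { toFun w := R u v w z
      map_add' w w' := h.add_third u v w w' z
      map_smul' a w := by rw [h.pair_symm, h.smul_left, h.pair_symm w]; rfl }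
  change L _ = ∑ i ∈ t, a i * L (w i)
  simp

/-! ### Linear algebra in a tangent space. -/

section LinearAlgebra

variable {x : M}

theorem exists_ne_zero_inner_eq_zero {ι : Type*} [Fintype ι]
    (a : ι → TangentSpace 𝓘(ℝ, E) x) (h : Fintype.card ι < Module.finrank ℝ E) :
    ∃ v : TangentSpace 𝓘(ℝ, E) x, v ≠ 0 ∧ ∀ i, g.inner x v (a i) = 0 := by
  let L : TangentSpace 𝓘(ℝ, E) x →ₗ[ℝ] ι → ℝ :=
    LinearMap.pi fun i ↦ (g.inner x (a i)).toLinearMap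
  have hL : LinearMap.ker L ≠ ⊥ := by
    apply LinearMap.ker_ne_bot_of_finrank_lt
    rw [Module.finrank_pi]
    exact h
  obtain ⟨v, hv, hv0⟩ := (Submodule.ne_bot_iff _).1 hL
  refine ⟨v, hv0, fun i ↦ ?_⟩
  rw [g.symm]
  exact congrFun (LinearMap.mem_ker.1 hv) i

theorem gram_pos {u v : TangentSpace 𝓘(ℝ, E) x} (h : LinearIndependent ℝ ![u, v]) :
    0 < g.inner x u u * g.inner x v v - g.inner x u v ^ 2 := by
  have hv : v ≠ 0 := h.ne_zero 1
  have hvv := g.pos x v hv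
  rw [LinearIndependent.pair_iff] at h
  -- g(v, v) times the component of u orthogonal to v; its square length is g(v, v) times the Gram
  -- determinant.
  have hw : g.inner x v v • u + (-g.inner x u v) • v ≠ 0 := fun h0 ↦ hvv.ne' (h _ _ h0).1
  have h1 := g.pos x _ hw
  simp only [map_add, add_apply, map_smul, smul_apply, smul_eq_mul, g.symm x v u] at h1
  have h2 : 0 < g.inner x v v * (g.inner x u u * g.inner x v v - g.inner x u v ^ 2) := by
    linarith
  exact pos_of_mul_pos_right h2 hvv.le

/-- Parseval; the cardinality makes the orthonormal family a basis. -/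
theorem IsOrthonormal.sum_inner_mul_inner {ι : Type*} [Fintype ι] [DecidableEq ι]
    {e : ι → TangentSpace 𝓘(ℝ, E) x} (he : IsOrthonormal g x e)
    (hcard : Fintype.card ι = Module.finrank ℝ E) (u v : TangentSpace 𝓘(ℝ, E) x) :
    ∑ i, g.inner x (e i) u * g.inner x (e i) v = g.inner x u v := by
  have hsum (c : ι → ℝ) (j : ι) : g.inner x (e j) (∑ i, c i • e i) = c j := by
    rw [map_sum]
    simp [he j _]
  have hli : LinearIndependent ℝ e := by
    rw [Fintype.linearIndependent_iff]
    intro c hc j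
    rw [← hsum c j, hc, map_zero]
  have hspan := hli.span_eq_top_of_card_eq_finrank' hcard
  have hv : v ∈ Submodule.span ℝ (Set.range e) := by rw [hspan]; trivial
  obtain ⟨c, rfl⟩ := (Submodule.mem_span_range_iff_exists_fun ℝ).1 hv
  simp only [hsum]
  rw [map_sum]
  refine Finset.sum_congr rfl fun i _ ↦ ?_
  rw [map_smul, g.symm, smul_eq_mul, mul_comm]

end LinearAlgebra

/-! ### Constant 𝓛-sectional curvature. -/

namespace MetricFStructure

variable {g} {s : ℕ} (S : MetricFStructure g s) {x : M}

/-- The fibre of the distribution `𝓛` as a subspace. -/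
def subspaceL (x : M) : Submodule ℝ (TangentSpace 𝓘(ℝ, E) x) where
  carrier := {u | ∀ α, S.η α x u = 0}
  add_mem' hu hv α := by rw [map_add, hu α, hv α, add_zero]
  zero_mem' α := map_zero _
  smul_mem' a u hu α := by rw [map_smul, hu α, smul_zero]

theorem mem_subspaceL {u : TangentSpace 𝓘(ℝ, E) x} : u ∈ S.subspaceL x ↔ ∀ α, S.η α x u = 0 :=
  Iff.rfl

theorem mem_distL_iff {u : TangentSpace 𝓘(ℝ, E) x} : u ∈ S.distL x ↔ u ∈ S.subspaceL x := by
  simp only [distL, Set.mem_ofPred_eq, mem_subspaceL, S.η_eq_inner]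

theorem f_mem_subspaceL (u : TangentSpace 𝓘(ℝ, E) x) : S.f x u ∈ S.subspaceL x :=
  fun α ↦ S.η_f x α u

variable {S} in
/-- Constant sectional curvature on `𝓛` determines the curvature tensor on `𝓛`. -/
theorem HasConstantLSectionalCurvature.curvatureForm_eq {c : ℝ}
    (hc : S.HasConstantLSectionalCurvature c) {u v w z : TangentSpace 𝓘(ℝ, E) x}
    (hu : u ∈ S.subspaceL x) (hv : v ∈ S.subspaceL x) (hw : w ∈ S.subspaceL x)
    (hz : z ∈ S.subspaceL x) : curvatureForm g x u v w z
      = c * (g.inner x v w * g.inner x u z - g.inner x u w * g.inner x v z) := by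
  have hR := isCurvatureLike_curvatureForm g x
  have hB := hR.sub_smul (isCurvatureLike_inner g x) c
  refine sub_eq_zero.1 (hB.eq_zero_of_sectional (S.subspaceL x) ?_ hu hv hw hz)
  intro u hu v hv
  by_cases h : LinearIndependent ℝ ![u, v]
  · have h1 := hc x u v (S.mem_distL_iff.2 hu) (S.mem_distL_iff.2 hv) h
    rw [sectionalCurvature, div_eq_iff (gram_pos g h).ne'] at h1
    rw [curvatureForm, h1, g.symm x v u]
    ring
  -- Dependent pairs are not covered by the hypothesis; there the form vanishes by its symmetries.
  · rcases eq_or_ne u 0 with rfl | hu0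
    · have := hB.smul_left 0 0 v v 0
      rw [zero_smul, zero_mul] at this
      exact this
    · rw [LinearIndependent.pair_iff' hu0] at h
      push Not at h
      obtain ⟨a, rfl⟩ := h
      have := hB.smul_mid a u u (a • u) u
      rw [hB.self_left, mul_zero] at this
      exact this

namespace IsS

variable {S} {c : ℝ}

/-- The commutator identity at (u, v, fu, v) with v orthogonal to u and fu reads c |u|² |v|² = s
|u|² |v|². -/
theorem eq_of_hasConstantLSectionalCurvature (hS : S.IsS) (hc : S.HasConstantLSectionalCurvature c)
    (hs : 1 ≤ s) (hdim : s + 2 < Module.finrank ℝ E) (x : M) : c = s := by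
  obtain ⟨u, hu0, hu⟩ := exists_ne_zero_inner_eq_zero g (fun α ↦ S.ξ α x)
    (by rw [Fintype.card_fin]; omega)
  -- Orthogonality to all ξ_α, u and fu imposes s + 2 linear conditions, which is why the dimension
  -- must exceed s + 2.
  obtain ⟨v, hv0, hv⟩ := exists_ne_zero_inner_eq_zero g
    (Sum.elim (fun α ↦ S.ξ α x) ![u, S.f x u])
    (by rw [Fintype.card_sum, Fintype.card_fin, Fintype.card_fin]; exact hdim)
  have huL : u ∈ S.subspaceL x := S.mem_distL_iff.1 hu
  have hvL : v ∈ S.subspaceL x := S.mem_distL_iff.1 fun α ↦ hv (.inl α)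
  have hvu : g.inner x v u = 0 := hv (.inr 0)
  have hvfu : g.inner x v (S.f x u) = 0 := hv (.inr 1)
  have huv : g.inner x u v = 0 := by rw [g.symm, hvu]
  have hffu : S.f x (S.f x u) = -u := by
    rw [S.f_f, Finset.sum_eq_zero, add_zero]
    intro α _
    rw [huL α, zero_smul]
  have h := hS.curvatureForm_f hs u v (S.f_mem_subspaceL u) hvL
  rw [hffu, hc.curvatureForm_eq huL hvL (neg_mem huL) hvL,
    hc.curvatureForm_eq huL hvL (S.f_mem_subspaceL u) (S.f_mem_subspaceL v)] at h
  have huf : g.inner x u (S.f x u) = 0 := by linarith [S.inner_f_left u u, g.symm x u (S.f x u)]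
  simp only [S.inner_f_f_of_η_eq_zero huL, map_neg, hvu, huv, hvfu, huf] at h
  have hne : g.inner x u u * g.inner x v v ≠ 0 := mul_ne_zero (g.pos x u hu0).ne' (g.pos x v hv0).ne'
  apply mul_right_cancel₀ hne
  linarith

/-- The curvature of an `S`-manifold with constant `𝓛`-sectional curvature on arbitrary planes. -/
theorem curvatureForm_sectional (hS : S.IsS) (hc : S.HasConstantLSectionalCurvature c) (hs : 1 ≤ s)
    (u v : TangentSpace 𝓘(ℝ, E) x) :
    curvatureForm g x u v v u
      = c * (g.inner x (S.f x u) (S.f x u) * g.inner x (S.f x v) (S.f x v)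
          - g.inner x (S.f x u) (S.f x v) ^ 2)
        + (∑ α, S.η α x v) ^ 2 * g.inner x (S.f x u) (S.f x u)
        + (∑ α, S.η α x u) ^ 2 * g.inner x (S.f x v) (S.f x v)
        - 2 * (∑ α, S.η α x u) * (∑ α, S.η α x v) * g.inner x (S.f x u) (S.f x v) := by
  have hR := isCurvatureLike_curvatureForm g x
  -- The orthogonal projection onto 𝓛 is -f².
  let p (w : TangentSpace 𝓘(ℝ, E) x) : TangentSpace 𝓘(ℝ, E) x := -S.f x (S.f x w)
  have hp (w) : w = p w + ∑ α, S.η α x w • S.ξ α x := by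
    simp only [p, S.f_f]
    abel
  have hpL (w) : p w ∈ S.subspaceL x := neg_mem (S.f_mem_subspaceL _)
  have hσ (w) : ∑ α, S.η α x (p w) = 0 := Finset.sum_eq_zero fun α _ ↦ hpL w α
  have hpg (w w') : g.inner x (p w) (p w') = g.inner x (S.f x w) (S.f x w') := by
    simp only [p, map_neg, neg_apply, neg_neg]
    exact S.inner_f_f_of_η_eq_zero (S.f_mem_subspaceL w') _
  have hfp (w) : S.f x (p w) = S.f x w := by
    simp only [p, map_neg, S.f_f x (S.f x w), S.η_f, zero_smul, Finset.sum_const_zero, add_zero,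
      neg_neg]
  have hξ (u v w z : TangentSpace 𝓘(ℝ, E) x) :
      curvatureForm g x u v w z = curvatureForm g x u v (p w) z
        + (∑ α, S.η α x w) * ((∑ β, S.η β x v) * g.inner x (S.f x u) (S.f x z)
          - (∑ β, S.η β x u) * g.inner x (S.f x v) (S.f x z)) := by
    conv_lhs => rw [hp w, hR.add_third, hR.sum_smul_third]
    simp only [hS.curvatureForm_ξ_eq hs, Finset.sum_mul]
  -- The symmetries of R bring each of the four arguments in turn to the third slot, where `hξ`
  -- splits off its ξ-part.
  have h1 := hξ u v v u
  have h2 := hξ u v u (p v)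
  have h3 := hξ (p v) (p u) u v
  have h4 := hξ (p v) (p u) v (p u)
  have h5 := hc.curvatureForm_eq (hpL v) (hpL u) (hpL u) (hpL v)
  simp only [hσ, hfp, hpg, zero_mul, sub_zero, mul_zero, add_zero] at h2 h3 h4 h5
  rw [g.symm x (S.f x v) (S.f x u)] at h1 h5
  linarith [hR.swap_right u v (p v) u, hR.swap_right u v (p v) (p u), hR.pair_symm u v (p v) (p u),
    hR.swap_right (p v) (p u) (p u) v, hR.swap_right (p v) (p u) (p u) (p v),
    hR.swap_right u v u (p v), hR.swap_right (p v) (p u) v (p u)]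

/-- In the basis e, the forms η^α are the rows of A with A Aᵀ = 1. Hence Q = 1 - Aᵀ A is the matrix
of the projection onto 𝓛, of trace r = dim 𝓛, and σ = Σ η^α satisfies |σ|² = s and Qσ = 0; these
identities evaluate every double sum. -/
theorem scalarCurvature_eq (hS : S.IsS) (hc : S.HasConstantLSectionalCurvature c) (hs : 1 ≤ s)
    {ι : Type*} [Fintype ι] [DecidableEq ι] {e : ι → TangentSpace 𝓘(ℝ, E) x}
    (he : IsOrthonormal g x e) (hcard : Fintype.card ι = Module.finrank ℝ E) {r : ℝ}
    (hr : (Fintype.card ι : ℝ) = r + s) :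
    scalarCurvature g x e = (1 / 2) * (c * (r ^ 2 - r) + 2 * s * r) := by
  let A : Matrix (Fin s) ι ℝ := Matrix.of fun α i ↦ S.η α x (e i)
  have hA : A * A.transpose = 1 := by
    ext α β
    rw [Matrix.mul_apply]
    simp only [Matrix.transpose_apply, A, Matrix.of_apply, S.η_eq_inner]
    rw [he.sum_inner_mul_inner g hcard, S.inner_ξ_ξ, Matrix.one_apply]
  let Q : Matrix ι ι ℝ := 1 - A.transpose * A
  have hQ (i j) : g.inner x (S.f x (e i)) (S.f x (e j)) = Q i j := by
    rw [S.inner_f_f, he i j]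
    simp [Q, A, Matrix.mul_apply, Matrix.one_apply]
  have hQQ : Q * Q = Q := by
    have : A.transpose * A * (A.transpose * A) = A.transpose * A := by
      rw [Matrix.mul_assoc, ← Matrix.mul_assoc A, hA, Matrix.one_mul]
    simp only [Q, Matrix.sub_mul, Matrix.mul_sub, Matrix.one_mul, Matrix.mul_one, this]
    abel
  have hQs (i j) : Q i j = Q j i := by rw [← hQ, ← hQ, g.symm]
  have htr : ∑ i, Q i i = r := by
    have : Q.trace = Fintype.card ι - s := by
      simp only [Q, Matrix.trace_sub, Matrix.trace_mul_comm A.transpose, hA, Matrix.trace_one,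
        Fintype.card_fin]
    rw [hr, add_sub_cancel_right] at this
    exact this
  let σ : ι → ℝ := Matrix.vecMul 1 A
  have hσ (i) : ∑ α, S.η α x (e i) = σ i := by
    simp [σ, A, Matrix.vecMul, dotProduct]
  have hσσ : ∑ i, σ i ^ 2 = s := by
    have : σ ⬝ᵥ σ = s := by
      rw [show σ = Matrix.vecMul 1 A from rfl]
      conv_lhs => rw [← Matrix.mulVec_transpose A, Matrix.dotProduct_mulVec, Matrix.vecMul_transpose,
        Matrix.mulVec_transpose, ← Matrix.mulVec_transpose A, Matrix.mulVec_mulVec, hA]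
      simp [dotProduct]
    simpa [dotProduct, sq] using this
  have hQσ (i) : ∑ j, Q i j * σ j = 0 := by
    have : Matrix.mulVec Q σ = 0 := by
      rw [show σ = Matrix.vecMul 1 A from rfl, ← Matrix.mulVec_transpose, Matrix.mulVec_mulVec]
      simp only [Q, Matrix.sub_mul, Matrix.one_mul, Matrix.mul_assoc, hA, Matrix.mul_one, sub_self,
        Matrix.zero_mulVec]
    exact congrFun this i
  have hK (i j) : sectionalCurvature g x (e i) (e j)
      = c * (Q i i * Q j j) - c * (Q i j * Q j i) + σ j ^ 2 * Q i i + σ i ^ 2 * Q j j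
        - 2 * (σ i * (Q i j * σ j)) := by
    have h1 : sectionalCurvature g x (e i) (e j) = curvatureForm g x (e i) (e j) (e j) (e i) := by
      rw [sectionalCurvature, he, he, he]
      -- On the diagonal both numerator and denominator vanish and 0 / 0 = 0; off it the denominator
      -- is 1.
      by_cases h : i = j
      · subst h
        rw [(isCurvatureLike_curvatureForm g x).self_left]
        simp
      · simp [h, curvatureForm]
    rw [h1, hS.curvatureForm_sectional hc hs]
    simp only [hQ, hσ, hQs j i]
    ring
  have e1 : ∑ i, ∑ j, Q i i * Q j j = r ^ 2 := by
    rw [← Finset.sum_mul_sum, htr, sq]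
  have e2 : ∑ i, ∑ j, Q i j * Q j i = r := by
    simp only [← Matrix.mul_apply, hQQ, htr]
  have e3 : ∑ i, ∑ j, σ j ^ 2 * Q i i = s * r := by
    simp only [← Finset.sum_mul, hσσ, ← Finset.mul_sum, htr]
  have e4 : ∑ i, ∑ j, σ i ^ 2 * Q j j = s * r := by
    simp only [← Finset.sum_mul, hσσ, ← Finset.mul_sum, htr]
  have e5 : ∑ i, ∑ j, σ i * (Q i j * σ j) = 0 := by
    simp only [← Finset.mul_sum, hQσ, mul_zero, Finset.sum_const_zero]
  simp only [scalarCurvature, hK, Finset.sum_sub_distrib, Finset.sum_add_distrib,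
    ← Finset.mul_sum _ _ c, ← Finset.mul_sum _ _ (2 : ℝ), e1, e2, e3, e4, e5]
  ring

end IsS
end MetricFStructure

end

end SManifold

theorem theorem3p1 {E : Type*} [NormedAddCommGroup E] [NormedSpace ℝ E] [FiniteDimensional ℝ E]
    {M : Type*} [TopologicalSpace M] [T2Space M] [ChartedSpace E M] [IsManifold 𝓘(ℝ, E) ∞ M]
    [Nonempty M]
    (n s : ℕ) (hn : 2 ≤ n) (hs : 1 ≤ s) (hdim : Module.finrank ℝ E = 2 * n + s)
    (g : ContMDiffRiemannianMetric 𝓘(ℝ, E) ∞ E (fun x : M ↦ TangentSpace 𝓘(ℝ, E) x))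
    (S : SManifold.MetricFStructure g s) (hS : S.IsS)
    (c : ℝ) (hc : S.HasConstantLSectionalCurvature c) :
    c = s ∧
      ∀ (x : M) (e : Fin (2 * n + s) → TangentSpace 𝓘(ℝ, E) x),
        SManifold.IsOrthonormal g x e →
          SManifold.scalarCurvature g x e = n * s * (2 * n + 1) := by
  obtain ⟨x₀⟩ := ‹Nonempty M›
  -- Here n ≥ 2 enters, as s + 2 < 2n + s; a point is needed because the equality is proved in one
  -- tangent space.
  have hcs : c = s := hS.eq_of_hasConstantLSectionalCurvature hc hs (by omega) x₀
  refine ⟨hcs, fun x e he ↦ ?_⟩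
  -- With r = 2n and c = s, the value is (s (4n² - 2n) + 4sn) / 2.
  rw [hS.scalarCurvature_eq hc hs he (by rw [Fintype.card_fin, hdim]) (r := 2 * n)
    (by rw [Fintype.card_fin]; push_cast; ring), hcs]
  ring
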